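/- Let $a<b$ be real numbers and let $\omega$ be a nonempty open set with $\overline{\omega}\subset(a,b)$. Let $\mathbb{L}^2=L^2(a,b)\times\mathbb{R}^2$ (real scalars) with $\|(u,c,d)\|^2=\|u\|_{L^2(a,b)}^2+c^2+d^2$, and let $\mathbf{A}$ be the operator on $\mathbb{L}^2$ with domain $\{(u,u(a),u(b)) : u\in H^2(a,b)\}$ and $$\mathbf{A}(u,u(a),u(b))=(\partial_{xx}u,\ \partial_xu(a),\ -\partial_xu(b)).$$ A solution on $[0,T]$ of the heat equation with dynamic boundary conditions is a curve $\vartheta=(\upsilon,\upsilon(a,\cdot),\upsilon(b,\cdot))\in C([0,T];\mathbb{L}^2)$ that is differentiable on $(0,T)$ with $\vartheta(t)\in D(\mathbf{A})$ and $\vartheta'(t)=\mathbf{A}\vartheta(t)$ there. For $0<\tau<T$, $\Psi^0\in\mathbb{L}^2$ and $h\in L^2(\omega)$, the solution of the impulsive system is the curve $\Psi:[0,T]\to\mathbb{L}^2$, continuous on $[0,\tau)$ and on $[\tau,T]$, differentiable on $(0,T)\setminus\{\tau\}$ with $\Psi(t)\in D(\mathbf{A})$ and $\Psi'(t)=\mathbf{A}\Psi(t)$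 there, such that $\Psi(0)=\Psi^0$, the left limit $\Psi(\tau^-)$ exists, and $\Psi(\tau)=\Psi(\tau^-)+(\mathbb{1}_\omega h,0,0)$. Theorem. There are constants $\mathcal{M}_1,\mathcal{M}_2,\delta>0$, depending only on $a,b,\omega$, such that the following holds. (i) For every $T>0$, every solution $\vartheta=(\upsilon,\upsilon(a,\cdot),\upsilon(b,\cdot))$ on $[0,T]$ of the heat equation with dynamic boundary conditions, and every $\varepsilon>0$, $$\|\vartheta(T)\|^2\le\Big(\frac{\mathcal{M}_1e^{\mathcal{M}_2/T}}{\varepsilon^{\delta}}\Big)^2\|\upsilon(\cdot,T)\|_{L^2(\omega)}^2+\varepsilon^2\|\vartheta(0)\|^2 .$$ (ii) For all $T>0$ and $\tau\in(0,T)$, the impulsive system is null approximate impulse controllable at time $T$: for all $\varepsilon>0$ and $\Psi^0\in\mathbb{L}^2$ there is $h\in L^2(\omega)$ such that the corresponding solution satisfies $\|\Psi(T)\|\le\varepsilon\|\Psi^0\|$. It is also approximately impulse controllable: for all $\Psi^0,\Psi^T\in\mathbb{L}^2$ and $\varepsilon>0$ there is $h\in L^2(\omega)$ such that the corresponding solution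 satisfies $\|\Psi(T)-\Psi^T\|\le\varepsilon$. (iii) For all $T>0$, $\tau\in(0,T)$ and $\varepsilon>0$, the control cost $$K(T,\varepsilon)=\sup_{\|\Psi^0\|=1}\ \inf\{\|h\|_{L^2(\omega)} : h\in L^2(\omega),\ \text{the corresponding solution satisfies } \|\Psi(T)\|\le\varepsilon\|\Psi^0\|\}$$ satisfies $$K(T,\varepsilon)\le\frac{\mathcal{M}_1e^{\mathcal{M}_2/(T-\tau)}}{\varepsilon^{\delta}} .$$ -/

import Mathlib

open Set Filter Topology MeasureTheory
open scoped ENNReal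

noncomputable section

namespace ImpulseHeat

/-- The real Lebesgue space `L²(ω)` for a set `ω ⊆ ℝ`. -/
abbrev L2 (ω : Set ℝ) : Type := Lp ℝ 2 (volume.restrict ω)

/-- The state space `L²(a,b) × ℝ²` with its Hilbert norm
`‖(u, c, d)‖² = ‖u‖² + c² + d²`. -/
abbrev State (a b : ℝ) : Type := WithLp 2 (L2 (Ioo a b) × EuclideanSpace ℝ (Fin 2))

/-- `v` is the weak derivative of `u` on the interval `(a,b)`. -/
def HasWeakDeriv (a b : ℝ) (u v : ℝ → ℝ) : Prop :=
  ∀ φ : ℝ → ℝ, ContDiff ℝ (⊤ : ℕ∞) φ → HasCompactSupport φ → tsupport φ ⊆ Ioo a b →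
    ∫ x in Ioo a b, u x * deriv φ x = -∫ x in Ioo a b, v x * φ x

/-- The graph of the heat operator with dynamic boundary conditions: `U = (u, c, d)` is in the
domain and `A U = V = (w, p, q)`. This says that `u ∈ H²(a,b)`, that `c = u(a)`, `d = u(b)`, and
that `w = ∂ₓₓ u`, `p = ∂ₓ u (a)`, `q = -∂ₓ u (b)`. Here `f` and `g` are the representatives of
`u` and of its weak derivative `∂ₓ u` that are continuous on `[a,b]`, through which the boundary
values are taken; the second weak derivative is required to be the element `w` of `L²(a,b)`. -/
def IsHeatOperator {a b : ℝ} (U V : State a b) : Prop :=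
  ∃ f g : ℝ → ℝ,
    ContinuousOn f (Icc a b) ∧ ContinuousOn g (Icc a b) ∧
    (U.fst : ℝ → ℝ) =ᵐ[volume.restrict (Ioo a b)] f ∧
    HasWeakDeriv a b f g ∧ HasWeakDeriv a b g V.fst ∧
    U.snd 0 = f a ∧ U.snd 1 = f b ∧
    V.snd 0 = g a ∧ V.snd 1 = -g b

/-- `ϑ` solves, on `[0,T]`, the heat equation with dynamic boundary conditions (no impulse):
`∂ₜ ϑ = A ϑ` on `(0,T)`, with `ϑ` continuous on `[0,T]` as a curve in `L²(a,b) × ℝ²`.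
The initial datum is `ϑ 0`. -/
structure IsHeatSolution {a b : ℝ} (T : ℝ) (ϑ : ℝ → State a b) : Prop where
  continuousOn : ContinuousOn ϑ (Icc 0 T)
  equation : ∀ t ∈ Ioo 0 T, ∃ V, IsHeatOperator (ϑ t) V ∧ HasDerivAt ϑ V t

/-- Extension by zero `𝟙_ω h ∈ L²(a,b)` of `h ∈ L²(ω)`. -/
def extendZero (a b : ℝ) {ω : Set ℝ} (hω : IsOpen ω) (h : L2 ω) : L2 (Ioo a b) :=
  MemLp.toLp (ω.indicator (h : ℝ → ℝ)) <| by
    rw [memLp_indicator_iff_restrict hω.measurableSet]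
    refine (Lp.memLp h).mono_measure ?_
    rw [Measure.restrict_restrict hω.measurableSet]
    exact Measure.restrict_mono inter_subset_left le_rfl

/-- The jump `(𝟙_ω h, 0, 0)`. -/
def impulse (a b : ℝ) {ω : Set ℝ} (hω : IsOpen ω) (h : L2 ω) : State a b :=
  WithLp.toLp 2 (extendZero a b hω h, 0)

/-- `Ψ` solves the impulsive heat equation with dynamic boundary conditions on `[0,T]`,
with initial datum `Ψ₀` and impulse `h` at time `τ`. -/
structure IsImpulsiveSolution {a b : ℝ} {ω : Set ℝ} (hω : IsOpen ω) (T τ : ℝ)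
    (Ψ₀ : State a b) (h : L2 ω) (Ψ : ℝ → State a b) : Prop where
  initial : Ψ 0 = Ψ₀
  continuousOn_before : ContinuousOn Ψ (Ico 0 τ)
  continuousOn_after : ContinuousOn Ψ (Icc τ T)
  equation : ∀ t ∈ Ioo 0 T \ {τ}, ∃ V, IsHeatOperator (Ψ t) V ∧ HasDerivAt Ψ V t
  jump : ∃ Ψm, Tendsto Ψ (𝓝[<] τ) (𝓝 Ψm) ∧ Ψ τ = Ψm + impulse a b hω h

/-- The solution of the impulsive system with datum `Ψ₀` and impulse `h` has a final state
`Ψ(T)` satisfying `P`: a solution exists, and the final state of any solution satisfies `P`. -/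
def FinalState {a b : ℝ} {ω : Set ℝ} (hω : IsOpen ω) (T τ : ℝ)
    (Ψ₀ : State a b) (h : L2 ω) (P : State a b → Prop) : Prop :=
  (∃ Ψ, IsImpulsiveSolution hω T τ Ψ₀ h Ψ) ∧
    ∀ Ψ, IsImpulsiveSolution hω T τ Ψ₀ h Ψ → P (Ψ T)

/-- The impulse controls that steer `Ψ₀` to a state with `‖Ψ(T)‖ ≤ ε ‖Ψ₀‖`. -/
def nullControls {a b : ℝ} {ω : Set ℝ} (hω : IsOpen ω) (T τ : ℝ)
    (Ψ₀ : State a b) (ε : ℝ) : Set (L2 ω) :=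
  {h | FinalState hω T τ Ψ₀ h fun X => ‖X‖ ≤ ε * ‖Ψ₀‖}

/-- Null approximate impulse controllability at time `T`. -/
def NullApproxControllable (a b : ℝ) {ω : Set ℝ} (hω : IsOpen ω) (T τ : ℝ) : Prop :=
  ∀ ε : ℝ, 0 < ε → ∀ Ψ₀ : State a b, (nullControls hω T τ Ψ₀ ε).Nonempty

/-- Approximate impulse controllability at time `T`. -/
def ApproxControllable (a b : ℝ) {ω : Set ℝ} (hω : IsOpen ω) (T τ : ℝ) : Prop :=
  ∀ Ψ₀ Ψ₁ : State a b, ∀ ε : ℝ, 0 < ε → ∃ h : L2 ω, FinalState hω T τ Ψ₀ h fun X => ‖X - Ψ₁‖ ≤ ε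

/-- The cost of null approximate impulse control,
`K(T,ε) = sup_{‖Ψ₀‖ = 1} inf_h ‖h‖`, as an element of `[0,∞]`. -/
def controlCost (a b : ℝ) {ω : Set ℝ} (hω : IsOpen ω) (T τ ε : ℝ) : ℝ≥0∞ :=
  ⨆ (Ψ₀ : State a b) (_ : ‖Ψ₀‖ = 1), ⨅ h ∈ nullControls hω T τ Ψ₀ ε, ‖h‖ₑ

end ImpulseHeat

end

open scoped InnerProductSpace

noncomputable section
namespace ImpulseHeat

/-! ### Primitives and weak derivatives -/

/-! Write `A` for the heat operator. The central estimate is a spectral inequality: a state built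
from eigenvectors of `-A` with eigenvalues at most `Λ` is bounded by `C exp(c √Λ)` times the `L²(ω)`
norm of its first component (`exists_spectral_inequality`). Such a state satisfies `‖A^k U‖ ≤ Λ^k
‖U‖`, and `A^k U` carries the derivative of order `2k`. Hence `U` differs from its Taylor polynomial
of degree below `2m` by about `(√Λ (b - a))^(2m) / (2m)!`. A polynomial of degree below `n` that is
small on a subinterval of `ω` is, by Lagrange interpolation, small on `[a,b]` up to a factor
geometric in `n`. Taking `n` of order `√Λ` makes the remainder absorbable. The resulting bound is
uniform on `[a,b]`, so it covers the two boundary components as well.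

The eigenvectors come from an abstract argument. Integrating twice inverts `-A` on the orthogonal
complement of the constant state, and this inverse is `J J*` with `J` the mean-free primitive. It is
compact, symmetric and nonnegative, so `A` is diagonal in a Hilbert basis (`exists_heat_eigenbasis`)
and the semigroup multiplies coordinates by `exp(-λ t)`.

Observation at the single time `T` then follows from a frequency cutoff at `X²`. Low frequencies
cost `exp(c X)`, while high frequencies have decayed by `exp(-X² T)`. The quadratic exponent wins,
and a suitable `X` gives a constant of the form `M₁ exp(M₂ / T) / ε^δ` (`exists_observability`).

Control is dual to observation: the semigroup is self-adjoint, so the adjoint of the map from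
impulse to final state restricts the evolved state to `ω`. Minimizing a penalized quadratic
functional turns the observability constant into the cost of the control
(`exists_control_of_observability`). Letting `ε` tend to zero gives unique continuation, hence dense
range and approximate controllability. -/

theorem integral_mul_primitive_add {a b : ℝ} {g u : ℝ → ℝ}
    (hg : IntervalIntegrable g volume a b) (hu : IntervalIntegrable u volume a b) :
    (∫ x in a..b, g x * ∫ s in a..x, u s) + ∫ x in a..b, (∫ s in a..x, g s) * u x
      = (∫ s in a..b, g s) * ∫ s in a..b, u s := by
  have hG := hg.absolutelyContinuousOnInterval_intervalIntegral (c := a) (by simp)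
  have hU := hu.absolutelyContinuousOnInterval_intervalIntegral (c := a) (by simp)
  have h := hG.integral_deriv_mul_eq_sub hU
  simp only [intervalIntegral.integral_same, mul_zero, sub_zero] at h
  rw [← h, ← intervalIntegral.integral_add (hg.mul_continuousOn hU.continuousOn)
    (hu.continuousOn_mul hG.continuousOn)]
  apply intervalIntegral.integral_congr_ae
  filter_upwards [hg.ae_hasDerivAt_integral, hu.ae_hasDerivAt_integral] with x h1 h2 hx
  have hx' := uIoc_subset_uIcc hx
  rw [(h1 hx' a (by simp)).deriv, (h2 hx' a (by simp)).deriv]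

theorem ae_eq_zero_of_primitive_eq_const {a b : ℝ} (hab : a ≤ b) {u : ℝ → ℝ} {c : ℝ}
    (hu : IntervalIntegrable u volume a b) (h : ∀ x ∈ Ioo a b, ∫ s in a..x, u s = c) :
    ∀ᵐ x ∂volume.restrict (Ioo a b), u x = 0 := by
  rw [ae_restrict_iff' measurableSet_Ioo]
  filter_upwards [hu.ae_hasDerivAt_integral] with x h1 hx
  have h2 := h1 (by rw [uIcc_of_le hab]; exact Ioo_subset_Icc_self hx) a (by simp)
  have h3 : (fun y => ∫ s in a..y, u s) =ᶠ[𝓝 x] fun _ => c :=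
    Filter.eventually_of_mem (isOpen_Ioo.mem_nhds hx) h
  exact h2.unique ((hasDerivAt_const x c).congr_of_eventuallyEq h3)

theorem setIntegral_Ioo_eq {a b : ℝ} (hab : a ≤ b) (f : ℝ → ℝ) :
    ∫ x in Ioo a b, f x = ∫ x in a..b, f x := by
  rw [intervalIntegral.integral_of_le hab, integral_Ioc_eq_integral_Ioo]

theorem eq_zero_of_tsupport_subset_Ioo {a b : ℝ} {φ : ℝ → ℝ} (h : tsupport φ ⊆ Ioo a b) :
    φ a = 0 ∧ φ b = 0 :=
  ⟨image_eq_zero_of_notMem_tsupport fun h' => lt_irrefl _ (h h').1,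
    image_eq_zero_of_notMem_tsupport fun h' => lt_irrefl _ (h h').2⟩

/-- A test function is the primitive of its own derivative and vanishes at both ends, so integration
by parts leaves no boundary term. -/
theorem hasWeakDeriv_of_eq_primitive {a b : ℝ} (hab : a ≤ b) {f g : ℝ → ℝ} {c : ℝ}
    (hg : IntervalIntegrable g volume a b)
    (hf : ∀ x ∈ Icc a b, f x = c + ∫ s in a..x, g s) : HasWeakDeriv a b f g := by
  intro φ hφ _ hsup
  obtain ⟨h0, h1⟩ := eq_zero_of_tsupport_subset_Ioo hsup
  have hφ' : Continuous (deriv φ) := hφ.continuous_deriv (by simp)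
  have hprim : ∀ x, ∫ s in a..x, deriv φ s = φ x := fun x => by
    rw [intervalIntegral.integral_deriv_eq_sub
      (fun y _ => (hφ.differentiable (by simp)).differentiableAt) (hφ'.intervalIntegrable _ _),
      h0, sub_zero]
  have key := integral_mul_primitive_add hg (hφ'.intervalIntegrable a b)
  simp only [hprim, h1, mul_zero] at key
  have hG := hg.absolutelyContinuousOnInterval_intervalIntegral (c := a) (by simp)
  rw [setIntegral_Ioo_eq hab, setIntegral_Ioo_eq hab]
  calc ∫ x in a..b, f x * deriv φ x
      = ∫ x in a..b, (c * deriv φ x + (∫ s in a..x, g s) * deriv φ x) := by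
        apply intervalIntegral.integral_congr
        intro x hx
        rw [uIcc_of_le hab] at hx
        simp only [hf x hx]; ring
    _ = c * (∫ x in a..b, deriv φ x) + ∫ x in a..b, (∫ s in a..x, g s) * deriv φ x := by
        rw [intervalIntegral.integral_add ((hφ'.intervalIntegrable a b).const_mul c)
          ((hφ'.intervalIntegrable a b).continuousOn_mul hG.continuousOn),
          intervalIntegral.integral_const_mul]
    _ = _ := by rw [hprim, h1]; linarith

theorem exists_contDiff_integral_eq_one {a b : ℝ} (hab : a < b) :
    ∃ ρ : ℝ → ℝ, ContDiff ℝ (⊤ : ℕ∞) ρ ∧ HasCompactSupport ρ ∧ tsupport ρ ⊆ Ioo a b ∧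
      ∫ x in a..b, ρ x = 1 := by
  let B : ContDiffBump ((a + b) / 2) := ⟨(b - a) / 8, (b - a) / 4, by linarith, by linarith⟩
  have hs : tsupport (B.normed volume) ⊆ Ioo a b := by
    rw [B.tsupport_normed_eq, Real.closedBall_eq_Icc]
    intro x hx
    simp only [B, mem_Icc] at hx
    exact ⟨by linarith [hx.1], by linarith [hx.2]⟩
  refine ⟨B.normed volume, B.contDiff_normed, B.hasCompactSupport_normed, hs, ?_⟩
  rw [← setIntegral_Ioo_eq hab.le, setIntegral_eq_integral_of_forall_compl_eq_zero, B.integral_normed]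
  intro x hx
  exact image_eq_zero_of_notMem_tsupport fun h => hx (hs h)

/-- A smooth function compactly supported in `(a,b)` with zero mean is the derivative of such a
function. -/
theorem exists_testFunction_deriv_eq {a b : ℝ} {ψ : ℝ → ℝ}
    (hψ : ContDiff ℝ (⊤ : ℕ∞) ψ) (hs : tsupport ψ ⊆ Ioo a b) (hc : HasCompactSupport ψ)
    (h0 : ∫ x in a..b, ψ x = 0) :
    ∃ φ : ℝ → ℝ, ContDiff ℝ (⊤ : ℕ∞) φ ∧ HasCompactSupport φ ∧ tsupport φ ⊆ Ioo a b ∧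
      deriv φ = ψ := by
  rcases le_or_gt b a with hba | hab
  · have : tsupport ψ = ∅ := by
      rw [Ioo_eq_empty_of_le hba] at hs; exact subset_empty_iff.1 hs
    rw [tsupport_eq_empty_iff] at this
    refine ⟨0, contDiff_const, HasCompactSupport.zero, ?_, ?_⟩
    · rw [tsupport_eq_empty_iff.2 rfl]; exact empty_subset _
    · rw [this]; ext x; simp
  have hder : ∀ x, HasDerivAt (fun x => ∫ s in a..x, ψ s) (ψ x) x := fun x =>
    intervalIntegral.integral_hasDerivAt_right (hψ.continuous.intervalIntegrable _ _)
      (hψ.continuous.stronglyMeasurableAtFilter _ _) hψ.continuous.continuousAt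
  have hderiv : deriv (fun x => ∫ s in a..x, ψ s) = ψ := funext fun x => (hder x).deriv
  -- the support of `ψ` lies in a compact subinterval
  obtain ⟨α, β, hα, hαβ, hβ, hsub⟩ : ∃ α β, a < α ∧ α ≤ β ∧ β < b ∧ tsupport ψ ⊆ Icc α β := by
    rcases (tsupport ψ).eq_empty_or_nonempty with h | h
    · exact ⟨(a + b) / 2, (a + b) / 2, by linarith, le_rfl, by linarith, by simp [h]⟩
    · have hk : IsCompact (tsupport ψ) := hc
      refine ⟨sInf (tsupport ψ), sSup (tsupport ψ), (hs (hk.sInf_mem h)).1, ?_,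
        (hs (hk.sSup_mem h)).2, fun x hx => ⟨csInf_le hk.bddBelow hx, le_csSup hk.bddAbove hx⟩⟩
      exact le_csSup hk.bddAbove (hk.sInf_mem h)
  have hz : ∀ x, x ∉ Icc α β → ψ x = 0 := fun x hx =>
    image_eq_zero_of_notMem_tsupport fun h => hx (hsub h)
  have hint : ∀ x y, IntervalIntegrable ψ volume x y := fun x y =>
    hψ.continuous.intervalIntegrable _ _
  -- Left of `α` the integrand vanishes. Right of `β` the zero mean turns the integral from `a` to
  -- `x` into minus the integral from `x` to `b`, which vanishes too.
  have hsupp : Function.support (fun x => ∫ s in a..x, ψ s) ⊆ Icc α β := by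
    intro x hx
    by_contra hx'
    apply hx
    rw [mem_Icc, not_and_or, not_le, not_le] at hx'
    rcases hx' with hx' | hx'
    · refine (intervalIntegral.integral_congr (g := fun _ => 0) fun y hy => hz y fun h => ?_).trans
        (by simp)
      have := (mem_uIcc.1 hy)
      rcases this with h' | h' <;> linarith [h.1, h'.2]
    · have h2 : ∫ s in x..b, ψ s = 0 := by
        refine (intervalIntegral.integral_congr (g := fun _ => 0)
          fun y hy => hz y fun h => ?_).trans (by simp)
        have := (mem_uIcc.1 hy)
        rcases this with h' | h' <;> linarith [h.2, h'.1]
      have := intervalIntegral.integral_add_adjacent_intervals (hint a x) (hint x b)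
      simp only
      linarith
  have hts : tsupport (fun x => ∫ s in a..x, ψ s) ⊆ Icc α β :=
    closure_minimal hsupp isClosed_Icc
  refine ⟨_, ?_, HasCompactSupport.of_support_subset_isCompact isCompact_Icc hsupp,
    fun x hx => ⟨hα.trans_le (hts hx).1, (hts hx).2.trans_lt hβ⟩, hderiv⟩
  -- Since `∞ + 1 = ∞`, smoothness of the derivative gives smoothness of the primitive.
  rw [show ((⊤ : ℕ∞) : WithTop ℕ∞) = (⊤ : ℕ∞) + 1 from rfl, contDiff_succ_iff_deriv]
  refine ⟨fun x => (hder x).differentiableAt, by simp, by rw [hderiv]; exact hψ⟩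

/-- The du Bois-Reymond lemma. -/
theorem ae_eq_const_of_hasWeakDeriv_zero {a b : ℝ} (hab : a < b) {u : ℝ → ℝ}
    (hu : IntervalIntegrable u volume a b) (h : HasWeakDeriv a b u 0) :
    ∃ c, ∀ᵐ x ∂volume.restrict (Ioo a b), u x = c := by
  obtain ⟨ρ, hρ, hρc, hρs, hρ1⟩ := exists_contDiff_integral_eq_one hab
  -- The constant is the mean of `u` weighted by `ρ`. For a test function `ψ` with integral `m`, the
  -- function `ψ - m ρ` has zero integral, so it is the derivative of a test function and `u` is
  -- orthogonal to it.
  refine ⟨∫ x in a..b, u x * ρ x, ?_⟩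
  set c := ∫ x in a..b, u x * ρ x with hc
  have hU : IntegrableOn (fun x => u x - c) (Ioo a b) := by
    have := (intervalIntegrable_iff_integrableOn_Ioo_of_le hab.le).1
      (hu.sub (intervalIntegrable_const (c := c)))
    exact this
  have := isOpen_Ioo.ae_eq_zero_of_integral_contDiff_smul_eq_zero
    (f := fun x => u x - c) (U := Ioo a b) (μ := volume) hU.locallyIntegrableOn ?_
  · rw [ae_restrict_iff' measurableSet_Ioo]
    filter_upwards [this] with x hx hx'
    linarith [hx hx']
  intro ψ hψ hψc hψs
  have hψ' : IntervalIntegrable ψ volume a b := hψ.continuous.intervalIntegrable _ _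
  have hρ' : IntervalIntegrable ρ volume a b := hρ.continuous.intervalIntegrable _ _
  set m := ∫ x in a..b, ψ x with hm
  have hsup : tsupport (fun x => ψ x - m * ρ x) ⊆ tsupport ψ ∪ tsupport ρ := by
    apply closure_minimal _ ((isClosed_tsupport _).union (isClosed_tsupport _))
    intro x hx
    by_contra hx'
    rw [mem_union, not_or] at hx'
    exact hx (by simp [image_eq_zero_of_notMem_tsupport hx'.1,
      image_eq_zero_of_notMem_tsupport hx'.2])
  obtain ⟨φ, h1, h2, h3, h4⟩ := exists_testFunction_deriv_eq (a := a) (b := b)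
    (ψ := fun x => ψ x - m * ρ x) (hψ.sub (contDiff_const.mul hρ))
    (hsup.trans (union_subset hψs hρs))
    (((IsCompact.union hψc hρc)).of_isClosed_subset (isClosed_tsupport _) hsup)
    (by rw [intervalIntegral.integral_sub hψ' (hρ'.const_mul m),
      intervalIntegral.integral_const_mul, hρ1]; simp [hm])
  have h5 := h φ h1 h2 h3
  rw [h4, setIntegral_Ioo_eq hab.le] at h5
  have huψ := hu.mul_continuousOn hψ.continuous.continuousOn
  have huρ := hu.mul_continuousOn hρ.continuous.continuousOn
  have h6 : ∫ x in a..b, u x * (ψ x - m * ρ x) = (∫ x in a..b, u x * ψ x) - m * c := by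
    rw [hc, ← intervalIntegral.integral_const_mul, ← intervalIntegral.integral_sub huψ
      (huρ.const_mul m)]
    congr 1; ext x; ring
  have h7 : ∫ x in a..b, ψ x • (u x - c) = (∫ x in a..b, u x * ψ x) - c * m := by
    rw [hm, ← intervalIntegral.integral_const_mul, ← intervalIntegral.integral_sub huψ
      (hψ'.const_mul c)]
    congr 1; ext x; simp only [smul_eq_mul]; ring
  rw [← setIntegral_eq_integral_of_forall_compl_eq_zero (s := Ioo a b), setIntegral_Ioo_eq hab.le, h7]
  · rw [h6] at h5; simp at h5; linarith
  · intro x hx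
    rw [image_eq_zero_of_notMem_tsupport fun h => hx (hψs h), zero_smul]

/-- The difference between `f` and the primitive of `g` has zero weak derivative, so it is constant
almost everywhere. Continuity up to the endpoints makes this an identity on all of `[a,b]`, where
the boundary values are read. -/
theorem HasWeakDeriv.eq_primitive {a b : ℝ} (hab : a < b) {f g : ℝ → ℝ}
    (hf : ContinuousOn f (Icc a b)) (hg : IntervalIntegrable g volume a b)
    (h : HasWeakDeriv a b f g) : ∀ x ∈ Icc a b, f x = f a + ∫ s in a..x, g s := by
  have hG := (hg.absolutelyContinuousOnInterval_intervalIntegral (c := a) (by simp)).continuousOn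
  rw [uIcc_of_le hab.le] at hG
  have hfi : IntervalIntegrable f volume a b :=
    ContinuousOn.intervalIntegrable (by rwa [uIcc_of_le hab.le])
  have hGi : IntervalIntegrable (fun x => ∫ s in a..x, g s) volume a b :=
    ContinuousOn.intervalIntegrable (by rwa [uIcc_of_le hab.le])
  have hw : HasWeakDeriv a b (fun x => f x - ∫ s in a..x, g s) 0 := by
    intro φ h1 h2 h3
    have hφ' : Continuous (deriv φ) := h1.continuous_deriv (by simp)
    have e1 := h φ h1 h2 h3
    have e2 := hasWeakDeriv_of_eq_primitive hab.le (c := 0) hg (fun x _ => (zero_add _).symm)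
      φ h1 h2 h3
    rw [setIntegral_Ioo_eq hab.le] at e1 e2 ⊢
    simp only [sub_mul, Pi.zero_apply, zero_mul, integral_zero, neg_zero]
    rw [intervalIntegral.integral_sub (hfi.mul_continuousOn hφ'.continuousOn)
      (hGi.mul_continuousOn hφ'.continuousOn), e1, e2, sub_self]
  obtain ⟨c, hc⟩ := ae_eq_const_of_hasWeakDeriv_zero hab (hfi.sub hGi) hw
  have hc' : EqOn (fun x => f x - ∫ s in a..x, g s) (fun _ => c) (Icc a b) := by
    refine Measure.eqOn_Icc_of_ae_eq (μ := volume) hab.ne ?_ (hf.sub hG) continuousOn_const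
    rwa [← restrict_Ioo_eq_restrict_Icc]
  intro x hx
  have e1 := hc' hx
  have e2 := hc' (left_mem_Icc.2 hab.le)
  simp only [intervalIntegral.integral_same, sub_zero] at e1 e2
  linarith

/-! ### The state space -/

variable {a b : ℝ}

theorem intervalIntegrable_of_L2 (hab : a ≤ b) (u : L2 (Ioo a b)) :
    IntervalIntegrable (u : ℝ → ℝ) volume a b := by
  rw [intervalIntegrable_iff_integrableOn_Ioo_of_le hab]
  exact (Lp.memLp u).integrable one_le_two

theorem intervalIntegrable_of_L2' (hab : a ≤ b) (u : L2 (Ioo a b)) {x y : ℝ}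
    (hx : x ∈ Icc a b) (hy : y ∈ Icc a b) : IntervalIntegrable (u : ℝ → ℝ) volume x y :=
  (intervalIntegrable_of_L2 hab u).mono_set (by
    rw [uIcc_of_le hab]; exact (convex_Icc a b).ordConnected.uIcc_subset hx hy)

theorem continuousOn_primitive_L2 (hab : a ≤ b) (u : L2 (Ioo a b)) :
    ContinuousOn (fun x => ∫ s in a..x, u s) (Icc a b) := by
  have := ((intervalIntegrable_of_L2 hab u).absolutelyContinuousOnInterval_intervalIntegral
    (c := a) (by simp)).continuousOn
  rwa [uIcc_of_le hab] at this

/-- Pairing with an indicator makes interval integrals bounded linear functionals of the class of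
`u`; linearity and the Cauchy–Schwarz bound come from this form. -/
theorem integral_eq_inner_indicator (u : L2 (Ioo a b)) {x y : ℝ} (hxy : x ≤ y)
    (hx : a ≤ x) (hy : y ≤ b) :
    ∫ s in x..y, u s = ⟪indicatorConstLp 2 (μ := volume.restrict (Ioo a b))
      (measurableSet_Ioc : MeasurableSet (Ioc x y)) (measure_ne_top _ _) (1 : ℝ), u⟫_ℝ := by
  rw [L2.inner_indicatorConstLp_one, Measure.restrict_restrict measurableSet_Ioc,
    intervalIntegral.integral_of_le hxy]
  apply setIntegral_congr_set
  rcases eq_or_lt_of_le hy with rfl | hy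
  · have : Ioc x y ∩ Ioo a y = Ioo x y := by
      ext z; simp only [mem_inter_iff, mem_Ioc, mem_Ioo]
      constructor
      · rintro ⟨⟨h1, h2⟩, h3, h4⟩; exact ⟨h1, h4⟩
      · rintro ⟨h1, h2⟩; exact ⟨⟨h1, h2.le⟩, hx.trans_lt h1, h2⟩
    rw [this]; exact Ioo_ae_eq_Ioc.symm
  · have : Ioc x y ∩ Ioo a b = Ioc x y := by
      apply inter_eq_left.2
      intro z hz; exact ⟨hx.trans_lt hz.1, hz.2.trans_lt hy⟩
    exact Eq.eventuallyEq this.symm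

/-- Cauchy–Schwarz against the indicator. The smallness on short intervals is what later makes the
primitive operator compact. -/
theorem abs_integral_le_sqrt_mul_norm (u : L2 (Ioo a b)) {x y : ℝ} (hxy : x ≤ y)
    (hx : a ≤ x) (hy : y ≤ b) : |∫ s in x..y, u s| ≤ √(y - x) * ‖u‖ := by
  rw [integral_eq_inner_indicator u hxy hx hy]
  refine (abs_real_inner_le_norm _ _).trans (mul_le_mul_of_nonneg_right ?_ (norm_nonneg _))
  rw [norm_indicatorConstLp two_ne_zero ENNReal.ofNat_ne_top, norm_one, one_mul, Real.sqrt_eq_rpow]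
  simp only [ENNReal.toReal_ofNat]
  refine Real.rpow_le_rpow measureReal_nonneg ?_ (by norm_num)
  refine (ENNReal.toReal_mono (by simp) (Measure.restrict_apply_le _ _)).trans ?_
  simp [hxy]

theorem inner_L2_eq (hab : a ≤ b) (u v : L2 (Ioo a b)) :
    ⟪u, v⟫_ℝ = ∫ x in a..b, u x * v x := by
  rw [L2.inner_def, setIntegral_Ioo_eq hab]
  simp [mul_comm]

theorem inner_state_eq (X Y : State a b) :
    ⟪X, Y⟫_ℝ = ⟪X.fst, Y.fst⟫_ℝ + (X.snd 0 * Y.snd 0 + X.snd 1 * Y.snd 1) := by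
  rw [WithLp.prod_inner_apply]
  congr 1
  rw [PiLp.inner_apply, Fin.sum_univ_two]
  simp [mul_comm]

theorem norm_sq_state_eq (X : State a b) :
    ‖X‖ ^ 2 = ‖X.fst‖ ^ 2 + (X.snd 0 ^ 2 + X.snd 1 ^ 2) := by
  rw [← real_inner_self_eq_norm_sq, inner_state_eq, real_inner_self_eq_norm_sq]
  ring

theorem norm_fst_le (X : State a b) : ‖X.fst‖ ≤ ‖X‖ :=
  abs_le_of_sq_le_sq' (by rw [norm_sq_state_eq]; nlinarith [sq_nonneg (X.snd 0), sq_nonneg (X.snd 1)])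
    (norm_nonneg _) |>.2

theorem abs_snd_zero_le (X : State a b) : |X.snd 0| ≤ ‖X‖ :=
  abs_le_of_sq_le_sq (by rw [norm_sq_state_eq]; nlinarith [sq_nonneg ‖X.fst‖, sq_nonneg (X.snd 1)])
    (norm_nonneg _)

theorem state_ext {X Y : State a b} (h : (X.fst : ℝ → ℝ) =ᵐ[volume.restrict (Ioo a b)] Y.fst)
    (h0 : X.snd 0 = Y.snd 0) (h1 : X.snd 1 = Y.snd 1) : X = Y := by
  apply WithLp.ofLp_injective
  refine Prod.ext (Lp.ext h) ?_
  ext i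
  fin_cases i
  exacts [h0, h1]

variable (a b) in
/-- The constant state `(1, 1, 1)`, which spans the kernel of the heat operator. -/
def one : State a b := WithLp.toLp 2 (MemLp.toLp (fun _ => (1 : ℝ)) (memLp_const 1), !₂[1, 1])

@[simp] theorem one_snd_zero : (one a b).snd 0 = 1 := rfl
@[simp] theorem one_snd_one : (one a b).snd 1 = 1 := rfl

theorem one_fst : ((one a b).fst : ℝ → ℝ) =ᵐ[volume.restrict (Ioo a b)] fun _ => 1 :=
  MemLp.coeFn_toLp (memLp_const 1)

theorem inner_one_left (hab : a ≤ b) (X : State a b) :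
    ⟪one a b, X⟫_ℝ = (∫ x in a..b, X.fst x) + (X.snd 0 + X.snd 1) := by
  rw [inner_state_eq, inner_L2_eq hab]
  simp only [one_snd_zero, one_snd_one, one_mul]
  congr 1
  rw [← setIntegral_Ioo_eq hab, ← setIntegral_Ioo_eq hab]
  apply integral_congr_ae
  filter_upwards [one_fst] with x hx
  rw [hx, one_mul]

/-! ### The primitive operator and the resolvent-type operator -/

theorem memLp_of_continuousOn {f : ℝ → ℝ} (hf : ContinuousOn f (Icc a b)) :
    MemLp f 2 (volume.restrict (Ioo a b)) := by
  obtain ⟨C, hC⟩ := isCompact_Icc.exists_bound_of_continuousOn hf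
  refine MemLp.of_bound ((hf.mono Ioo_subset_Icc_self).aestronglyMeasurable measurableSet_Ioo) C ?_
  rw [ae_restrict_iff' measurableSet_Ioo]
  exact ae_of_all _ fun x hx => hC x (Ioo_subset_Icc_self hx)

theorem norm_L2_le_of_bound (hab : a ≤ b) (u : L2 (Ioo a b)) {C : ℝ} (hC : 0 ≤ C)
    (h : ∀ᵐ x ∂volume.restrict (Ioo a b), |u x| ≤ C) : ‖u‖ ≤ √(b - a) * C := by
  have := Lp.norm_le_of_ae_bound (f := u) hC h
  rw [Real.sqrt_eq_rpow]
  simpa [measureUnivNNReal, ENNReal.toReal_ofReal (sub_nonneg.2 hab), ENNReal.coe_toNNReal_eq_toReal]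
    using this

/-- The primitive `g ↦ ∫ₐˣ g` on `L²(a,b)`. -/
def primitive (hab : a ≤ b) : L2 (Ioo a b) →L[ℝ] L2 (Ioo a b) :=
  LinearMap.mkContinuous
    { toFun := fun g => MemLp.toLp _ (memLp_of_continuousOn (continuousOn_primitive_L2 hab g))
      map_add' := by
        intro g h
        apply Lp.ext
        refine (MemLp.coeFn_toLp _).trans (.trans ?_ (Lp.coeFn_add _ _).symm)
        filter_upwards [MemLp.coeFn_toLp (memLp_of_continuousOn (continuousOn_primitive_L2 hab g)),
          MemLp.coeFn_toLp (memLp_of_continuousOn (continuousOn_primitive_L2 hab h)),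
          ae_restrict_mem measurableSet_Ioo] with x h1 h2 hx
        rw [Pi.add_apply, h1, h2, integral_eq_inner_indicator _ hx.1.le le_rfl hx.2.le,
          integral_eq_inner_indicator _ hx.1.le le_rfl hx.2.le,
          integral_eq_inner_indicator _ hx.1.le le_rfl hx.2.le, inner_add_right]
      map_smul' := by
        intro c g
        apply Lp.ext
        refine (MemLp.coeFn_toLp _).trans (.trans ?_ (Lp.coeFn_smul _ _).symm)
        filter_upwards [MemLp.coeFn_toLp (memLp_of_continuousOn (continuousOn_primitive_L2 hab g)),
          ae_restrict_mem measurableSet_Ioo] with x h1 hx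
        simp only [RingHom.id_apply, Pi.smul_apply, smul_eq_mul]
        rw [h1, integral_eq_inner_indicator _ hx.1.le le_rfl hx.2.le,
          integral_eq_inner_indicator _ hx.1.le le_rfl hx.2.le, inner_smul_right] }
    (√(b - a) * √(b - a)) (by
      intro g
      rw [mul_assoc]
      refine norm_L2_le_of_bound hab _ (by positivity) ?_
      filter_upwards [MemLp.coeFn_toLp (memLp_of_continuousOn (continuousOn_primitive_L2 hab g)),
          ae_restrict_mem measurableSet_Ioo] with x h1 hx
      refine (congrArg abs h1).trans_le ((abs_integral_le_sqrt_mul_norm g hx.1.le le_rfl hx.2.le).trans ?_)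
      gcongr
      exact hx.2.le)

theorem primitive_ae_eq (hab : a ≤ b) (g : L2 (Ioo a b)) :
    (primitive hab g : ℝ → ℝ) =ᵐ[volume.restrict (Ioo a b)] fun x => ∫ s in a..x, g s :=
  MemLp.coeFn_toLp (memLp_of_continuousOn (continuousOn_primitive_L2 hab g))

/-- The functional `g ↦ ∫ₓʸ g` on `L²(a,b)`. -/
def integralFunctional (x y : ℝ) : L2 (Ioo a b) →L[ℝ] ℝ :=
  innerSL ℝ (indicatorConstLp 2 (μ := volume.restrict (Ioo a b))
      (measurableSet_Ioc : MeasurableSet (Ioc x y)) (measure_ne_top _ _) (1 : ℝ))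

theorem integralFunctional_apply (u : L2 (Ioo a b)) {x y : ℝ} (hxy : x ≤ y)
    (hx : a ≤ x) (hy : y ≤ b) : integralFunctional x y u = ∫ s in x..y, u s :=
  (integral_eq_inner_indicator u hxy hx hy).symm

variable (a b) in
/-- The inclusion `u ↦ (u, 0, 0)`. -/
def inlState : L2 (Ioo a b) →L[ℝ] State a b :=
  (WithLp.prodContinuousLinearEquiv 2 ℝ _ _).symm.toContinuousLinearMap ∘L
    ContinuousLinearMap.inl ℝ _ _

theorem inlState_apply (u : L2 (Ioo a b)) : inlState a b u = WithLp.toLp 2 (u, 0) := rfl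

theorem inner_inlState (u : L2 (Ioo a b)) (X : State a b) :
    ⟪inlState a b u, X⟫_ℝ = ⟪u, X.fst⟫_ℝ := by
  rw [inlState_apply, inner_state_eq]; simp

variable (a b) in
/-- The state `(0, 0, 1)`. -/
def rightEnd : State a b := WithLp.toLp 2 (0, !₂[0, 1])

/-- The operator `g ↦ (∫ₐˣ g, 0, ∫ₐᵇ g)`. -/
def primState (hab : a ≤ b) : L2 (Ioo a b) →L[ℝ] State a b :=
  inlState a b ∘L primitive hab + (integralFunctional a b).smulRight (rightEnd a b)

theorem primState_apply (hab : a ≤ b) (g : L2 (Ioo a b)) :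
    primState hab g = inlState a b (primitive hab g) + (∫ s in a..b, g s) • rightEnd a b := by
  rw [← integralFunctional_apply g hab le_rfl le_rfl]; rfl

theorem primState_fst (hab : a ≤ b) (g : L2 (Ioo a b)) :
    (primState hab g).fst = primitive hab g := by
  rw [primState_apply]; simp [inlState_apply, rightEnd]

theorem primState_snd_zero (hab : a ≤ b) (g : L2 (Ioo a b)) : (primState hab g).snd 0 = 0 := by
  rw [primState_apply]; simp [inlState_apply, rightEnd]

theorem primState_snd_one (hab : a ≤ b) (g : L2 (Ioo a b)) :
    (primState hab g).snd 1 = ∫ s in a..b, g s := by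
  rw [primState_apply]; simp [inlState_apply, rightEnd]

/-- The flux `x ↦ c + ∫ₐˣ u` of a state `(u, c, d)`. -/
def flux (hab : a ≤ b) (V : State a b) : L2 (Ioo a b) :=
  primitive hab V.fst + V.snd 0 • (one a b).fst

theorem flux_ae_eq (hab : a ≤ b) (V : State a b) :
    (flux hab V : ℝ → ℝ) =ᵐ[volume.restrict (Ioo a b)]
      fun x => V.snd 0 + ∫ s in a..x, V.fst s := by
  refine (Lp.coeFn_add _ _).trans ?_
  filter_upwards [primitive_ae_eq hab V.fst, Lp.coeFn_smul (V.snd 0) (one a b).fst, one_fst]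
    with x h1 h2 h3
  rw [Pi.add_apply, h1, h2, Pi.smul_apply, h3, smul_eq_mul, mul_one, add_comm]

/-- Integration by parts. Orthogonality to the constants says that the flux at `b` equals minus the
last component of `V`, so the boundary terms at `b` combine into the pairing with the flux. -/
theorem inner_primState (hab : a ≤ b) (g : L2 (Ioo a b)) {V : State a b}
    (hV : ⟪one a b, V⟫_ℝ = 0) : ⟪primState hab g, V⟫_ℝ = -⟪g, flux hab V⟫_ℝ := by
  have hg := intervalIntegrable_of_L2 hab g
  have hu := intervalIntegrable_of_L2 hab V.fst
  rw [inner_state_eq, primState_fst, primState_snd_zero, primState_snd_one, inner_L2_eq hab,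
    inner_L2_eq hab]
  rw [inner_one_left hab] at hV
  have hG := continuousOn_primitive_L2 hab V.fst
  rw [← uIcc_of_le hab] at hG
  have h1 : ∫ x in a..b, (primitive hab g) x * V.fst x
      = ∫ x in a..b, (∫ s in a..x, g s) * V.fst x := by
    rw [← setIntegral_Ioo_eq hab, ← setIntegral_Ioo_eq hab]
    apply integral_congr_ae
    filter_upwards [primitive_ae_eq hab g] with x hx
    rw [hx]
  have h2 : ∫ x in a..b, g x * (flux hab V) x
      = ∫ x in a..b, (V.snd 0 * g x + g x * ∫ s in a..x, V.fst s) := by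
    rw [← setIntegral_Ioo_eq hab, ← setIntegral_Ioo_eq hab]
    apply integral_congr_ae
    filter_upwards [flux_ae_eq hab V] with x hx
    rw [hx]; ring
  rw [h1, h2, intervalIntegral.integral_add (hg.const_mul _) (hg.mul_continuousOn hG),
    intervalIntegral.integral_const_mul]
  have key := integral_mul_primitive_add hg hu
  have h3 : V.snd 1 = -(∫ x in a..b, V.fst x) - V.snd 0 := by linarith
  rw [h3]
  linarith

/-- The projection onto the orthogonal complement of the constant state. -/
def projOne (a b : ℝ) : State a b →L[ℝ] State a b := (Submodule.span ℝ {one a b})ᗮ.starProjection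

theorem inner_projOne (X Y : State a b) : ⟪projOne a b X, Y⟫_ℝ = ⟪X, projOne a b Y⟫_ℝ :=
  Submodule.inner_starProjection_left_eq_right _ _ _

theorem projOne_eq_self {X : State a b} (h : ⟪one a b, X⟫_ℝ = 0) : projOne a b X = X :=
  Submodule.starProjection_eq_self_iff.2 (Submodule.mem_orthogonal_singleton_iff_inner_right.2 h)

theorem inner_one_projOne (X : State a b) : ⟪one a b, projOne a b X⟫_ℝ = 0 :=
  Submodule.mem_orthogonal_singleton_iff_inner_right.1 (Submodule.starProjection_apply_mem _ X)

theorem exists_eq_projOne_add (X : State a b) : ∃ c : ℝ, X = projOne a b X + c • one a b := by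
  have : X - projOne a b X ∈ Submodule.span ℝ {one a b} := by
    have := Submodule.sub_starProjection_mem_orthogonal (K := (Submodule.span ℝ {one a b})ᗮ) X
    rwa [Submodule.orthogonal_orthogonal] at this
  obtain ⟨c, hc⟩ := Submodule.mem_span_singleton.1 this
  exact ⟨c, by rw [hc]; abel⟩

theorem projOne_one : projOne a b (one a b) = 0 := by
  apply Submodule.starProjection_orthogonal_apply_eq_zero
  exact Submodule.mem_span_singleton_self _

/-- The mean-free primitive operator. -/
def meanFreePrim (hab : a ≤ b) : L2 (Ioo a b) →L[ℝ] State a b := projOne a b ∘L primState hab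

/-- The inverse of minus the heat operator on the orthogonal complement of the constants,
extended by zero. -/
def invHeat (hab : a ≤ b) : State a b →L[ℝ] State a b :=
  meanFreePrim hab ∘L (meanFreePrim hab).adjoint

theorem adjoint_meanFreePrim (hab : a ≤ b) (X : State a b) :
    (meanFreePrim hab).adjoint X = -flux hab (projOne a b X) := by
  apply ext_inner_left ℝ
  intro g
  rw [ContinuousLinearMap.adjoint_inner_right, inner_neg_right, ← inner_primState hab g
    (inner_one_projOne X)]
  exact inner_projOne _ _

/-- The form `J J*` of the inverse yields symmetry here and nonnegativity in `inner_invHeat_self`.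
-/
theorem invHeat_symm (hab : a ≤ b) (X Y : State a b) :
    ⟪invHeat hab X, Y⟫_ℝ = ⟪X, invHeat hab Y⟫_ℝ := by
  simp only [invHeat, ContinuousLinearMap.comp_apply]
  rw [← ContinuousLinearMap.adjoint_inner_right, ContinuousLinearMap.adjoint_inner_left]

theorem inner_invHeat_self (hab : a ≤ b) (X : State a b) :
    ⟪invHeat hab X, X⟫_ℝ = ‖(meanFreePrim hab).adjoint X‖ ^ 2 := by
  rw [← real_inner_self_eq_norm_sq, ContinuousLinearMap.adjoint_inner_right]; rfl

theorem invHeat_one (hab : a ≤ b) : invHeat hab (one a b) = 0 := by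
  have : (meanFreePrim hab).adjoint (one a b) = 0 := by
    apply ext_inner_left ℝ
    intro g
    rw [ContinuousLinearMap.adjoint_inner_right, inner_zero_right]
    exact (inner_projOne _ _).trans (by rw [projOne_one, inner_zero_right])
  rw [invHeat, ContinuousLinearMap.comp_apply, this, map_zero]

/-- The flux has a continuous representative, which must vanish identically. Its value at `a` is the
second component of `V`, its value at `b` then fixes the third, and differentiating it kills the
first. -/
theorem eq_zero_of_flux_eq_zero (hab : a < b) {V : State a b} (hV : ⟪one a b, V⟫_ℝ = 0)
    (h : flux hab.le V = 0) : V = 0 := by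
  have h1 : EqOn (fun x => V.snd 0 + ∫ s in a..x, V.fst s) (fun _ => 0) (Icc a b) := by
    refine Measure.eqOn_Icc_of_ae_eq (μ := volume) hab.ne ?_
      (continuousOn_const.add (continuousOn_primitive_L2 hab.le _)) continuousOn_const
    rw [← restrict_Ioo_eq_restrict_Icc]
    filter_upwards [flux_ae_eq hab.le V, (h ▸ Lp.coeFn_zero _ _ _ :
      (flux hab.le V : ℝ → ℝ) =ᵐ[volume.restrict (Ioo a b)] 0)] with x h1 h2
    rw [← h1, h2]; rfl
  have h0 : V.snd 0 = 0 := by simpa using h1 (left_mem_Icc.2 hab.le)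
  have h2 : ∫ s in a..b, V.fst s = 0 := by
    have := h1 (right_mem_Icc.2 hab.le)
    simp only at this; linarith
  rw [inner_one_left hab.le] at hV
  refine state_ext ?_ h0 (by simp only [WithLp.zero_snd, PiLp.zero_apply]; linarith)
  have h3 := ae_eq_zero_of_primitive_eq_const hab.le (c := 0)
    (intervalIntegrable_of_L2 hab.le V.fst) (fun x hx => by
      have := h1 (Ioo_subset_Icc_self hx)
      simp only at this; linarith)
  filter_upwards [h3, Lp.coeFn_zero ℝ 2 (volume.restrict (Ioo a b))] with x hx hx'
  rw [hx]; exact hx'.symm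

theorem exists_eq_smul_one_of_invHeat_eq_zero (hab : a < b) {X : State a b}
    (h : invHeat hab.le X = 0) : ∃ c : ℝ, X = c • one a b := by
  have h1 : (meanFreePrim hab.le).adjoint X = 0 := by
    have := inner_invHeat_self hab.le X
    rw [h, inner_zero_left] at this
    exact norm_eq_zero.1 (pow_eq_zero_iff two_ne_zero |>.1 this.symm)
  rw [adjoint_meanFreePrim, neg_eq_zero] at h1
  have := eq_zero_of_flux_eq_zero hab (inner_one_projOne X) h1
  obtain ⟨c, hc⟩ := exists_eq_projOne_add X
  exact ⟨c, by rw [this, zero_add] at hc; exact hc⟩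

/-- Integrating `V` twice from the left gives minus the inverse up to a constant state. The sign
comes from `adjoint_meanFreePrim`, the constant from removing the mean. -/
theorem invHeat_apply_of_inner_eq_zero (hab : a ≤ b) {V : State a b} (hV : ⟪one a b, V⟫_ℝ = 0) :
    ∃ c : ℝ, primState hab (flux hab V) = c • one a b - invHeat hab V := by
  obtain ⟨c, hc⟩ := exists_eq_projOne_add (primState hab (flux hab V))
  refine ⟨c, hc.trans ?_⟩
  rw [invHeat, ContinuousLinearMap.comp_apply, adjoint_meanFreePrim, projOne_eq_self hV, map_neg]
  rw [sub_neg_eq_add, add_comm]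
  rfl

/-- The representatives of `U` and of its derivative, when `A U = V`. -/
theorem IsHeatOperator.exists_repr (hab : a < b) {U V : State a b} (h : IsHeatOperator U V) :
    ∃ f g : ℝ → ℝ, (U.fst : ℝ → ℝ) =ᵐ[volume.restrict (Ioo a b)] f ∧
      (∀ x ∈ Icc a b, f x = U.snd 0 + ∫ s in a..x, g s) ∧
      (∀ x ∈ Icc a b, g x = V.snd 0 + ∫ s in a..x, V.fst s) ∧ ContinuousOn f (Icc a b) ∧
      ContinuousOn g (Icc a b) ∧ U.snd 1 = f b ∧ V.snd 1 = - g b := by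
  obtain ⟨f, g, hf, hg, hU, hfg, hgV, h0, h1, h2, h3⟩ := h
  refine ⟨f, g, hU, ?_, ?_, hf, hg, h1, h3⟩
  · rw [h0]
    exact hfg.eq_primitive hab hf (ContinuousOn.intervalIntegrable (by rwa [uIcc_of_le hab.le]))
  · rw [h2]
    exact hgV.eq_primitive hab hg (intervalIntegrable_of_L2 hab.le _)

/-- Solving `A U = V` means integrating `V` twice, first to the flux and then to `U`. The flux at
`b` is both computed and prescribed, and the compatibility of the two values is orthogonality to the
constants; `c` is the free element of the kernel. -/
theorem isHeatOperator_iff (hab : a < b) {U V : State a b} :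
    IsHeatOperator U V ↔ ⟪one a b, V⟫_ℝ = 0 ∧ ∃ c : ℝ, U = c • one a b - invHeat hab.le V := by
  have hflux : ∀ V : State a b, ∀ x ∈ Icc a b,
      ∫ s in a..x, (flux hab.le V) s = ∫ s in a..x, (V.snd 0 + ∫ r in a..s, V.fst r) := by
    intro V x hx
    rw [← setIntegral_Ioo_eq hx.1, ← setIntegral_Ioo_eq hx.1]
    exact integral_congr_ae (ae_restrict_of_ae_restrict_of_subset (Ioo_subset_Ioo_right hx.2)
      (flux_ae_eq hab.le V))
  constructor
  · intro h
    obtain ⟨f, g, hU, hf, hg, -, -, hU1, hV1⟩ := h.exists_repr hab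
    have hV : ⟪one a b, V⟫_ℝ = 0 := by
      rw [inner_one_left hab.le, hV1, hg b (right_mem_Icc.2 hab.le)]; ring
    refine ⟨hV, ?_⟩
    obtain ⟨c, hc⟩ := invHeat_apply_of_inner_eq_zero hab.le hV
    have hgf : ∀ x ∈ Icc a b, ∫ s in a..x, g s = ∫ s in a..x, (flux hab.le V) s := by
      intro x hx
      rw [hflux V x hx]
      apply intervalIntegral.integral_congr
      intro y hy
      rw [uIcc_of_le hx.1] at hy
      exact hg y ⟨hy.1, hy.2.trans hx.2⟩
    refine ⟨c + U.snd 0, ?_⟩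
    have : U = U.snd 0 • one a b + primState hab.le (flux hab.le V) := by
      refine state_ext ?_ ?_ ?_
      · refine hU.trans ?_
        rw [WithLp.add_fst, WithLp.smul_fst, primState_fst]
        filter_upwards [Lp.coeFn_add (U.snd 0 • (one a b).fst) (primitive hab.le (flux hab.le V)),
          Lp.coeFn_smul (U.snd 0) (one a b).fst, one_fst, primitive_ae_eq hab.le (flux hab.le V),
          ae_restrict_mem measurableSet_Ioo] with x h1 h2 h3 h4 hx
        rw [h1, Pi.add_apply, h2, Pi.smul_apply, h3, h4, hf x (Ioo_subset_Icc_self hx),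
          hgf x (Ioo_subset_Icc_self hx), smul_eq_mul, mul_one]
      · simp [primState_snd_zero]
      · rw [WithLp.add_snd, WithLp.smul_snd, PiLp.add_apply, PiLp.smul_apply, one_snd_one,
          primState_snd_one, hU1, hf b (right_mem_Icc.2 hab.le), hgf b (right_mem_Icc.2 hab.le)]
        simp
    calc U = _ := this
      _ = _ := by rw [hc, add_smul]; abel
  · rintro ⟨hV, c, hc⟩
    obtain ⟨c', hc'⟩ := invHeat_apply_of_inner_eq_zero hab.le hV
    have hU : U = (c - c') • one a b + primState hab.le (flux hab.le V) := by
      rw [hc, hc', sub_smul]; abel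
    have hgc : ContinuousOn (fun x => V.snd 0 + ∫ s in a..x, V.fst s) (Icc a b) :=
      continuousOn_const.add (continuousOn_primitive_L2 hab.le _)
    have hgi : IntervalIntegrable (fun x => V.snd 0 + ∫ s in a..x, V.fst s) volume a b :=
      ContinuousOn.intervalIntegrable (by rwa [uIcc_of_le hab.le])
    have hfc : ContinuousOn (fun x => (c - c') + ∫ s in a..x, (flux hab.le V) s) (Icc a b) :=
      continuousOn_const.add (continuousOn_primitive_L2 hab.le _)
    refine ⟨fun x => (c - c') + ∫ s in a..x, (flux hab.le V) s,
      fun x => V.snd 0 + ∫ s in a..x, V.fst s, hfc, hgc, ?_, ?_, ?_, ?_, ?_, ?_, ?_⟩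
    · rw [hU, WithLp.add_fst, WithLp.smul_fst, primState_fst]
      filter_upwards [Lp.coeFn_add ((c - c') • (one a b).fst) (primitive hab.le (flux hab.le V)),
        Lp.coeFn_smul (c - c') (one a b).fst, one_fst,
        primitive_ae_eq hab.le (flux hab.le V)] with x h1 h2 h3 h4
      rw [h1, Pi.add_apply, h2, Pi.smul_apply, h3, h4, smul_eq_mul, mul_one]
    · exact hasWeakDeriv_of_eq_primitive hab.le hgi fun x hx => by rw [hflux V x hx]
    · exact hasWeakDeriv_of_eq_primitive hab.le (intervalIntegrable_of_L2 hab.le _)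
        fun x _ => rfl
    · rw [hU]; simp [primState_snd_zero]
    · rw [hU, WithLp.add_snd, WithLp.smul_snd, PiLp.add_apply, PiLp.smul_apply, one_snd_one,
          primState_snd_one]; simp
    · simp
    · rw [inner_one_left hab.le] at hV
      linarith

/-! ### Compactness and the eigenbasis -/

theorem memLp_comp_of_finite {n : ℕ} (idx : ℝ → Fin n) (hidx : Measurable idx) (c : Fin n → ℝ) :
    MemLp (fun x => c (idx x)) 2 (volume.restrict (Ioo a b)) :=
  MemLp.of_bound ((measurable_of_finite c).comp hidx).aestronglyMeasurable ‖c‖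
    (ae_of_all _ fun _ => norm_le_pi_norm c _)

/-- Step functions on the pieces `{x | idx x = i}` of a measurable partition. -/
def stepFunction (a b : ℝ) {n : ℕ} (idx : ℝ → Fin n) (hidx : Measurable idx) :
    (Fin n → ℝ) →ₗ[ℝ] L2 (Ioo a b) where
  toFun c := MemLp.toLp _ (memLp_comp_of_finite idx hidx c)
  map_add' _ _ := MemLp.toLp_add _ _
  map_smul' r _ := MemLp.toLp_const_smul r _

theorem stepFunction_ae_eq {n : ℕ} (idx : ℝ → Fin n) (hidx : Measurable idx) (c : Fin n → ℝ) :
    (stepFunction a b idx hidx c : ℝ → ℝ) =ᵐ[volume.restrict (Ioo a b)] fun x => c (idx x) :=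
  MemLp.coeFn_toLp (memLp_comp_of_finite idx hidx c)

/-- The primitive is sampled at the left ends of `n + 1` equal cells. These finite-rank operators
converge in norm because a primitive varies over a cell of length `h` by at most `√h ‖g‖`. -/
theorem isCompactOperator_primitive (hab : a < b) : IsCompactOperator (primitive hab.le) := by
  have hidx : ∀ n : ℕ, Measurable
      (fun x : ℝ => Fin.ofNat (n + 1) ⌊(x - a) / ((b - a) / (n + 1))⌋₊) := fun n =>
    (measurable_from_nat (f := Fin.ofNat (n + 1))).comp (Nat.measurable_floor.comp (by fun_prop))
  let Φ : ∀ n : ℕ, (Fin (n + 1) → ℝ) →L[ℝ] L2 (Ioo a b) := fun n =>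
    (stepFunction a b _ (hidx n)).toContinuousLinearMap
  let E : ∀ n : ℕ, L2 (Ioo a b) →L[ℝ] (Fin (n + 1) → ℝ) := fun n =>
    ContinuousLinearMap.pi fun i => integralFunctional a (a + (i : ℕ) * ((b - a) / (n + 1)))
  refine isCompactOperator_of_tendsto (l := atTop) (F := fun n => Φ n ∘L E n) ?_
    (Eventually.of_forall fun n =>
      (isCompactOperator_of_locallyCompactSpace_dom (E n)).clm_comp (Φ n))
  have hlim : Tendsto (fun n : ℕ => √(b - a) * √((b - a) / ((n : ℝ) + 1))) atTop (𝓝 0) := by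
    have h1 : Tendsto (fun n : ℕ => (b - a) / ((n : ℝ) + 1)) atTop (𝓝 0) :=
      tendsto_const_div_atTop_nhds_zero_nat (b - a) |>.comp (tendsto_add_atTop_nat 1) |>.congr
        fun n => by simp
    have := ((Real.continuous_sqrt.tendsto 0).comp h1).const_mul (√(b - a))
    simpa using this
  rw [tendsto_iff_norm_sub_tendsto_zero]
  refine squeeze_zero (fun _ => norm_nonneg _) (fun n => ?_) hlim
  refine ContinuousLinearMap.opNorm_le_bound _ (by positivity) fun g => ?_
  rw [mul_assoc]
  refine norm_L2_le_of_bound hab.le _ (by positivity) ?_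
  set h := (b - a) / ((n : ℝ) + 1) with hh
  have hpos : 0 < h := div_pos (sub_pos.2 hab) (by positivity)
  have hnh : (n + 1) * h = b - a := by rw [hh]; field_simp
  rw [sub_apply]
  filter_upwards [Lp.coeFn_sub ((Φ n ∘L E n) g) (primitive hab.le g), primitive_ae_eq hab.le g,
    stepFunction_ae_eq (a := a) (b := b) _ (hidx n) (E n g), ae_restrict_mem measurableSet_Ioo]
    with x h1 h2 h3 hx
  rw [h1, Pi.sub_apply, h2]
  have h4 : ((Φ n ∘L E n) g) x = E n g (Fin.ofNat (n + 1) ⌊(x - a) / h⌋₊) := h3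
  have hq : 0 ≤ (x - a) / h := div_nonneg (sub_nonneg.2 hx.1.le) hpos.le
  have hlt : ⌊(x - a) / h⌋₊ < n + 1 := by
    rw [Nat.floor_lt hq, div_lt_iff₀ hpos]; push_cast; rw [hnh]; linarith [hx.2]
  -- `Fin.ofNat` reduces modulo `n + 1`; the preceding bound shows that this changes nothing for
  -- points of `(a,b)`.
  have hv : ((Fin.ofNat (n + 1) ⌊(x - a) / h⌋₊ : Fin (n + 1)) : ℕ) = ⌊(x - a) / h⌋₊ := by
    simp [Fin.ofNat, Nat.mod_eq_of_lt hlt]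
  set r := a + (⌊(x - a) / h⌋₊ : ℝ) * h with hr
  have hr1 : r ≤ x := by
    have := Nat.floor_le hq
    rw [le_div_iff₀ hpos] at this; linarith
  have hr2 : x - r ≤ h := by
    have := (Nat.lt_floor_add_one ((x - a) / h)).le
    rw [div_le_iff₀ hpos] at this; rw [hr]; linarith
  have har : a ≤ r := by rw [hr]; linarith [mul_nonneg (Nat.cast_nonneg (α := ℝ) ⌊(x - a) / h⌋₊) hpos.le]
  have h5 : E n g (Fin.ofNat (n + 1) ⌊(x - a) / h⌋₊) = ∫ s in a..r, g s := by
    simp only [E, ContinuousLinearMap.coe_pi', hv]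
    exact integralFunctional_apply g har le_rfl (hr1.trans hx.2.le)
  have hxm : x ∈ Icc a b := Ioo_subset_Icc_self hx
  have ham : a ∈ Icc a b := left_mem_Icc.2 hab.le
  have hrm : r ∈ Icc a b := ⟨har, hr1.trans hx.2.le⟩
  rw [h4, h5, abs_sub_comm, intervalIntegral.integral_interval_sub_left
    (intervalIntegrable_of_L2' hab.le g ham hxm) (intervalIntegrable_of_L2' hab.le g ham hrm)]
  refine (abs_integral_le_sqrt_mul_norm g hr1 har hx.2.le).trans ?_
  gcongr

theorem isCompactOperator_invHeat (hab : a < b) : IsCompactOperator (invHeat hab.le) := by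
  have h1 : IsCompactOperator (primState hab.le) := by
    have h2 := (isCompactOperator_primitive hab).clm_comp (inlState a b)
    have h3 := (isCompactOperator_of_locallyCompactSpace_dom
      (integralFunctional (a := a) (b := b) a b)).clm_comp
        ((ContinuousLinearMap.id ℝ ℝ).smulRight (rightEnd a b))
    exact h2.add h3
  exact (h1.clm_comp (projOne a b)).comp_clm (meanFreePrim hab.le).adjoint

universe u

/-- A compact self-adjoint operator has a Hilbert basis of eigenvectors. -/
theorem exists_hilbertBasis_eigenvectors {H : Type u} [NormedAddCommGroup H] [InnerProductSpace ℝ H]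
    [CompleteSpace H] {T : H →L[ℝ] H} (hT : IsCompactOperator T)
    (hsymm : (T : H →ₗ[ℝ] H).IsSymmetric) :
    ∃ (ι : Type u) (e : HilbertBasis ι ℝ H) (κ : ι → ℝ), ∀ i, T (e i) = κ i • e i := by
  have hcomplete : ∀ μ : ℝ, CompleteSpace (Module.End.eigenspace (T : H →ₗ[ℝ] H) μ) := by
    intro μ
    have : IsClosed (Module.End.eigenspace (T : H →ₗ[ℝ] H) μ : Set H) := by
      have : (Module.End.eigenspace (T : H →ₗ[ℝ] H) μ : Set H) = {x | T x = μ • x} := by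
        ext x; simp
      rw [this]; exact isClosed_eq T.continuous (continuous_const_smul μ)
    exact this.completeSpace_coe
  -- A Hilbert basis is chosen in the eigenspace of every real `μ`, the kernel included; most of
  -- these bases are empty. Their union is total because the eigenspaces of a compact symmetric
  -- operator span a dense subspace.
  choose w e _ using fun μ => exists_hilbertBasis ℝ (Module.End.eigenspace (T : H →ₗ[ℝ] H) μ)
  have hon := hsymm.orthogonalFamily_eigenspaces.orthonormal_sigma_orthonormal
    (v_family := fun μ i => e μ i) (fun μ => (e μ).orthonormal)
  refine ⟨Σ μ : ℝ, w μ, HilbertBasis.mkOfOrthogonalEqBot hon ?_, fun i => i.1, ?_⟩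
  · rw [eq_bot_iff, ← ContinuousLinearMap.orthogonalComplement_iSup_eigenspaces_eq_bot hT hsymm,
      ← Submodule.iInf_orthogonal]
    intro x hx
    rw [Submodule.mem_iInf]
    intro μ
    have : CompleteSpace (Module.End.eigenspace (T : H →ₗ[ℝ] H) μ) := hcomplete μ
    have h0 : (Module.End.eigenspace (T : H →ₗ[ℝ] H) μ).orthogonalProjectionOnto x = 0 := by
      apply (e μ).repr.injective
      ext i
      rw [HilbertBasis.repr_apply_apply, map_zero,
        Submodule.inner_orthogonalProjectionOnto_eq_of_mem_left]
      exact Submodule.mem_orthogonal _ _ |>.1 hx _ (Submodule.subset_span ⟨⟨μ, i⟩, rfl⟩)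
    exact Submodule.orthogonalProjectionOnto_eq_zero_iff.1 h0
  · rintro ⟨μ, i⟩
    rw [HilbertBasis.coe_mkOfOrthogonalEqBot]
    exact Module.End.mem_eigenspace_iff.1 (e μ i).2

/-- The heat operator is diagonal in a Hilbert basis, with nonpositive eigenvalues. -/
theorem exists_heat_eigenbasis (hab : a < b) :
    ∃ (ι : Type) (e : HilbertBasis ι ℝ (State a b)) (lam : ι → ℝ), (∀ i, 0 ≤ lam i) ∧
      ∀ U V, IsHeatOperator U V ↔ ∀ i, ⟪e i, V⟫_ℝ = -lam i * ⟪e i, U⟫_ℝ := by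
  obtain ⟨ι, e, κ, he⟩ := exists_hilbertBasis_eigenvectors (isCompactOperator_invHeat hab)
    (invHeat_symm hab.le)
  have hK : ∀ i X, ⟪e i, invHeat hab.le X⟫_ℝ = κ i * ⟪e i, X⟫_ℝ := fun i X => by
    rw [← invHeat_symm, he, real_inner_smul_left]
  have hκ : ∀ i, 0 ≤ κ i := fun i => by
    have h1 := inner_invHeat_self hab.le (e i)
    rw [he, real_inner_smul_left, real_inner_self_eq_norm_sq, e.orthonormal.1 i] at h1
    have := sq_nonneg ‖(meanFreePrim hab.le).adjoint (e i)‖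
    linarith
  have hone : ∀ i, κ i ≠ 0 → ⟪e i, one a b⟫_ℝ = 0 := fun i hi => by
    have := hK i (one a b)
    rw [invHeat_one, inner_zero_right] at this
    exact (mul_eq_zero.1 this.symm).resolve_left hi
  have hker : ∀ i, κ i = 0 → ∃ c : ℝ, e i = c • one a b := fun i hi =>
    exists_eq_smul_one_of_invHeat_eq_zero hab (by rw [he, hi, zero_smul])
  have hext : ∀ X Y : State a b, (∀ i, ⟪e i, X⟫_ℝ = ⟪e i, Y⟫_ℝ) → X = Y := fun X Y h => by
    apply e.repr.injective
    ext i
    rw [e.repr_apply_apply, e.repr_apply_apply, h]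
  -- The convention `0⁻¹ = 0` is the right value here: `κ i = 0` only on constant states, where `A`
  -- vanishes.
  refine ⟨ι, e, fun i => (κ i)⁻¹, fun i => inv_nonneg.2 (hκ i), fun U V => ?_⟩
  rw [isHeatOperator_iff hab]
  constructor
  · rintro ⟨hV, c, rfl⟩ i
    rw [inner_sub_right, real_inner_smul_right, hK]
    by_cases hi : κ i = 0
    · obtain ⟨d, hd⟩ := hker i hi
      simp only [hi, inv_zero, neg_zero, zero_mul]
      rw [hd, real_inner_smul_left, hV, mul_zero]
    · rw [hone i hi]; field_simp; ring
  · intro h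
    constructor
    · rw [← e.tsum_inner_mul_inner]
      convert tsum_zero with i
      rw [h i]
      by_cases hi : κ i = 0
      · simp [hi]
      · rw [real_inner_comm, hone i hi, zero_mul]
    -- In coordinates, `V = -κ⁻¹ U` where `κ ≠ 0`, so `U + κ V` vanishes there, and the outer factor
    -- `κ` removes the remaining coordinates.
    · have : invHeat hab.le (U + invHeat hab.le V) = 0 := by
        apply hext
        intro i
        rw [hK, inner_add_right, hK, h i, inner_zero_right]
        by_cases hi : κ i = 0
        · rw [hi, zero_mul]
        · field_simp; ring
      obtain ⟨c, hc⟩ := exists_eq_smul_one_of_invHeat_eq_zero hab this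
      exact ⟨c, by rw [← hc]; abel⟩

/-! ### Diagonal operators and the semigroup they generate -/

section Diagonal

variable {H : Type*} [NormedAddCommGroup H] [InnerProductSpace ℝ H] {ι : Type*}
  (e : HilbertBasis ι ℝ H)

theorem hilbertBasis_ext {x y : H} (h : ∀ i, ⟪e i, x⟫_ℝ = ⟪e i, y⟫_ℝ) : x = y := by
  apply e.repr.injective
  ext i
  rw [e.repr_apply_apply, e.repr_apply_apply, h]

theorem hasSum_inner_sq (x : H) : HasSum (fun i => ⟪e i, x⟫_ℝ ^ 2) (‖x‖ ^ 2) := by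
  have := e.hasSum_inner_mul_inner x x
  rw [real_inner_self_eq_norm_sq] at this
  have h : (fun i => ⟪e i, x⟫_ℝ ^ 2) = fun i => ⟪x, e i⟫_ℝ * ⟪e i, x⟫_ℝ := by
    ext i; rw [real_inner_comm, sq]
  rwa [h]

theorem norm_le_of_inner_le {x y : H} {C : ℝ} (hC : 0 ≤ C)
    (h : ∀ i, |⟪e i, y⟫_ℝ| ≤ C * |⟪e i, x⟫_ℝ|) : ‖y‖ ≤ C * ‖x‖ := by
  refine abs_le_of_sq_le_sq' ?_ (by positivity) |>.2
  rw [mul_pow]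
  refine hasSum_le (fun i => ?_) (hasSum_inner_sq e y) ((hasSum_inner_sq e x).mul_left (C ^ 2))
  rw [← sq_abs ⟪e i, y⟫_ℝ, ← sq_abs ⟪e i, x⟫_ℝ, ← mul_pow]
  exact pow_le_pow_left₀ (abs_nonneg _) (h i) 2

theorem exists_diagonal {m : ι → ℝ} {C : ℝ} (hC : 0 ≤ C) (hm : ∀ i, |m i| ≤ C) :
    ∃ T : H →L[ℝ] H, ∀ i x, ⟪e i, T x⟫_ℝ = m i * ⟪e i, x⟫_ℝ := by
  have hmem : ∀ x : H, Memℓp (fun i => m i * e.repr x i) 2 := fun x => by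
    have := lp.memℓp (e.repr x)
    rw [memℓp_gen_iff (by norm_num)] at this ⊢
    refine Summable.of_nonneg_of_le (fun i => by positivity) (fun i => ?_) (this.mul_left (C ^ 2))
    simp only [ENNReal.toReal_ofNat, Real.rpow_two, norm_mul, mul_pow, Real.norm_eq_abs]
    gcongr
    exact hm i
  have hval : ∀ x i, ⟪e i, e.repr.symm ⟨_, hmem x⟩⟫_ℝ = m i * ⟪e i, x⟫_ℝ := fun x i => by
    rw [← e.repr_apply_apply, ← e.repr_apply_apply, LinearIsometryEquiv.apply_symm_apply]
  refine ⟨LinearMap.mkContinuous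
    { toFun := fun x => e.repr.symm ⟨_, hmem x⟩
      map_add' := fun x y => hilbertBasis_ext e fun i => by
        rw [hval, inner_add_right, inner_add_right, hval, hval, mul_add]
      map_smul' := fun c x => hilbertBasis_ext e fun i => by
        rw [hval, RingHom.id_apply, real_inner_smul_right, real_inner_smul_right, hval]; ring }
    C (fun x => norm_le_of_inner_le e hC fun i => ?_), fun i x => hval x i⟩
  refine (congrArg abs (hval x i)).trans_le ?_
  rw [abs_mul]
  exact mul_le_mul_of_nonneg_right (hm i) (abs_nonneg _)

/-- A second-order Taylor remainder uniform in `l`, so that differentiability of each coordinate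
passes to the norm. Half of the decay `exp(-l t)` absorbs the growth of the remainder, and the other
half absorbs `l²` through `x² / 2 ≤ exp x`. -/
theorem abs_exp_sub_exp_add_le {l s t : ℝ} (hl : 0 ≤ l) (ht : 0 < t) (hs : |s - t| ≤ t / 2) :
    |Real.exp (-l * s) - Real.exp (-l * t) - (s - t) * (-l * Real.exp (-l * t))|
      ≤ 8 / t ^ 2 * |s - t| ^ 2 := by
  have h1 : |Real.exp (-l * (s - t)) - 1 - (-l * (s - t))|
      ≤ |-l * (s - t)| ^ 2 * Real.exp |-l * (s - t)| := by
    have := Complex.norm_exp_sub_sum_le_norm_mul_exp ((-l * (s - t) : ℝ) : ℂ) 2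
    rw [Complex.norm_real, Real.norm_eq_abs, ← Complex.ofReal_exp] at this
    refine le_trans (le_of_eq ?_) this
    rw [← Real.norm_eq_abs, ← Complex.norm_real]
    congr 1
    simp [Finset.sum_range_succ]
    ring
  have h2 : Real.exp (-l * s) - Real.exp (-l * t) - (s - t) * (-l * Real.exp (-l * t))
      = Real.exp (-l * t) * (Real.exp (-l * (s - t)) - 1 - (-l * (s - t))) := by
    have : Real.exp (-l * s) = Real.exp (-l * t) * Real.exp (-l * (s - t)) := by
      rw [← Real.exp_add]; ring_nf
    rw [this]; ring
  have h3 : (l * t / 2) ^ 2 / 2 ≤ Real.exp (l * t / 2) := by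
    simpa using Real.pow_div_factorial_le_exp (x := l * t / 2) (by positivity) 2
  have h4 : |-l * (s - t)| ≤ l * t / 2 := by
    rw [abs_mul, abs_neg, abs_of_nonneg hl]
    linarith [mul_le_mul_of_nonneg_left hs hl]
  rw [h2, abs_mul, abs_of_pos (Real.exp_pos _)]
  calc Real.exp (-l * t) * |Real.exp (-l * (s - t)) - 1 - (-l * (s - t))|
      ≤ Real.exp (-l * t) * (|-l * (s - t)| ^ 2 * Real.exp (l * t / 2)) := by
        gcongr
        exact h1.trans (by gcongr)
    _ = |-l * (s - t)| ^ 2 * Real.exp (-(l * t / 2)) := by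
        rw [mul_left_comm, ← Real.exp_add]; ring_nf
    _ = 8 / t ^ 2 * |s - t| ^ 2 * ((l * t / 2) ^ 2 / 2 * Real.exp (-(l * t / 2))) := by
        rw [abs_mul, abs_neg, mul_pow, sq_abs l]; field_simp; ring
    _ ≤ 8 / t ^ 2 * |s - t| ^ 2 * 1 := by
        gcongr
        rw [Real.exp_neg, ← div_eq_mul_inv, div_le_one (Real.exp_pos _)]
        exact h3
    _ = _ := mul_one _

/-- The contraction semigroup with generator `-diag lam`, and its regularization property. -/
theorem exists_semigroup {lam : ι → ℝ} (hlam : ∀ i, 0 ≤ lam i) :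
    ∃ S : ℝ → H →L[ℝ] H,
      (∀ t, 0 ≤ t → ∀ i x, ⟪e i, S t x⟫_ℝ = Real.exp (-lam i * t) * ⟪e i, x⟫_ℝ) ∧
      (∀ x, Continuous fun t => S t x) ∧
      ∀ t, 0 < t → ∀ x, ∃ V, (∀ i, ⟪e i, V⟫_ℝ = -lam i * ⟪e i, S t x⟫_ℝ) ∧
        HasDerivAt (fun s => S s x) V t := by
  -- Negative times are clipped to zero, which keeps every operator a contraction and the orbits
  -- continuous on the whole line.
  have hexp : ∀ t i, |Real.exp (-lam i * max t 0)| ≤ 1 := fun t i => by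
    rw [abs_of_pos (Real.exp_pos _), Real.exp_le_one_iff]
    nlinarith [mul_nonneg (hlam i) (le_max_right t 0)]
  choose S hS using fun t => exists_diagonal e zero_le_one (hexp t)
  have hnorm : ∀ t x, ‖S t x‖ ≤ ‖x‖ := fun t x => by
    rw [← one_mul ‖x‖]
    refine norm_le_of_inner_le e zero_le_one fun i => ?_
    rw [hS, abs_mul]
    exact mul_le_mul_of_nonneg_right (hexp t i) (abs_nonneg _)
  have hS' : ∀ t, 0 ≤ t → ∀ i x, ⟪e i, S t x⟫_ℝ = Real.exp (-lam i * t) * ⟪e i, x⟫_ℝ :=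
    fun t ht i x => by rw [hS, max_eq_left ht]
  refine ⟨S, hS', fun x => ?_, fun t ht x => ?_⟩
  -- Orbits of finite combinations of basis vectors are visibly continuous; contractivity makes
  -- every orbit a uniform limit of such orbits.
  · have hspan : ∀ y ∈ Submodule.span ℝ (range e), Continuous fun t => S t y := by
      intro y hy
      induction hy using Submodule.span_induction with
      | mem y hy =>
        obtain ⟨j, rfl⟩ := hy
        have : ∀ t, S t (e j) = Real.exp (-lam j * max t 0) • e j := fun t =>
          hilbertBasis_ext e fun i => by
            rw [hS, real_inner_smul_right]
            by_cases hij : i = j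
            · rw [hij]
            · rw [e.orthonormal.2 hij, mul_zero, mul_zero]
        simp only [this]
        fun_prop
      | zero => simpa using continuous_const
      | add y z _ _ hy hz => simpa only [map_add] using Continuous.fun_add hy hz
      | smul c y _ hy => simpa only [map_smul] using Continuous.fun_const_smul hy c
    refine continuous_of_uniform_approx_of_continuous fun u hu => ?_
    obtain ⟨ε, hε, hεu⟩ := Metric.mem_uniformity_dist.1 hu
    have hx : x ∈ closure (Submodule.span ℝ (range e) : Set H) := by
      rw [← Submodule.topologicalClosure_coe, e.dense_span]; trivial
    obtain ⟨y, hy, hxy⟩ := Metric.mem_closure_iff.1 hx ε hε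
    refine ⟨_, hspan y hy, fun t => hεu ?_⟩
    rw [dist_eq_norm, ← map_sub]
    exact (hnorm t _).trans_lt (by rwa [← dist_eq_norm])
  -- The smoothing effect: `l exp(-l t) ≤ 1 / t` uniformly in `l ≥ 0`, so the generator composed
  -- with `S t` is bounded.
  · have hm : ∀ i, |-lam i * Real.exp (-lam i * t)| ≤ 1 / t := fun i => by
      rw [abs_mul, abs_neg, abs_of_nonneg (hlam i), abs_of_pos (Real.exp_pos _), neg_mul,
        Real.exp_neg, ← div_eq_mul_inv, div_le_div_iff₀ (Real.exp_pos _) ht, one_mul]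
      linarith [Real.add_one_le_exp (lam i * t)]
    obtain ⟨D, hD⟩ := exists_diagonal e (by positivity) hm
    refine ⟨D x, fun i => by rw [hD, hS' t ht.le]; ring, ?_⟩
    rw [hasDerivAt_iff_isLittleO]
    have hbig : (fun s => S s x - S t x - (s - t) • D x) =O[𝓝 t] fun s => ‖s - t‖ ^ 2 := by
      refine Asymptotics.IsBigO.of_bound (8 / t ^ 2 * ‖x‖) ?_
      filter_upwards [Metric.closedBall_mem_nhds t (half_pos ht)] with s hs
      rw [Metric.mem_closedBall, Real.dist_eq] at hs
      have hs0 : 0 ≤ s := by linarith [(abs_le.1 hs).1]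
      rw [norm_pow, norm_norm, Real.norm_eq_abs, mul_right_comm]
      refine norm_le_of_inner_le e (by positivity) fun i => ?_
      rw [inner_sub_right, inner_sub_right, real_inner_smul_right, hS' s hs0, hS' t ht.le, hD,
        ← sub_mul, ← mul_assoc, ← sub_mul, abs_mul]
      exact mul_le_mul_of_nonneg_right (abs_exp_sub_exp_add_le (hlam i) ht hs) (abs_nonneg _)
    refine hbig.trans_isLittleO ?_
    have h0 : Tendsto (fun s => s - t) (𝓝 t) (𝓝 0) :=
      Continuous.tendsto' (by fun_prop) t 0 (sub_self t)
    exact (Asymptotics.isLittleO_norm_pow_id one_lt_two).comp_tendsto h0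

/-- Each coordinate solves a scalar equation, so multiplying it by `exp(lam i * t)` gives zero
derivative. The mean value theorem needs only continuity at the two end times. -/
theorem eq_semigroup_of_hasDerivAt {lam : ι → ℝ} {T : ℝ} {ϑ : ℝ → H}
    (hc : ContinuousOn ϑ (Icc 0 T))
    (hd : ∀ t ∈ Ioo 0 T, ∃ V, (∀ i, ⟪e i, V⟫_ℝ = -lam i * ⟪e i, ϑ t⟫_ℝ) ∧ HasDerivAt ϑ V t)
    (hT : 0 < T) (i : ι) : ⟪e i, ϑ T⟫_ℝ = Real.exp (-lam i * T) * ⟪e i, ϑ 0⟫_ℝ := by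
  set z : ℝ → ℝ := fun t => Real.exp (lam i * t) * ⟪e i, ϑ t⟫_ℝ with hz
  have hder : ∀ t ∈ Ioo 0 T, HasDerivAt z 0 t := fun t ht => by
    obtain ⟨V, hV, hϑ⟩ := hd t ht
    have h1 : HasDerivAt (fun t => Real.exp (lam i * t)) (Real.exp (lam i * t) * (lam i * 1)) t :=
      ((hasDerivAt_id t).const_mul (lam i)).exp
    have h2 : HasDerivAt (fun t => ⟪e i, ϑ t⟫_ℝ) ⟪e i, V⟫_ℝ t :=
      (innerSL ℝ (e i)).hasFDerivAt.comp_hasDerivAt t hϑ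
    refine (h1.mul h2).congr_deriv ?_
    rw [hV]; ring
  have hzc : ContinuousOn z (Icc 0 T) :=
    (Continuous.continuousOn (by fun_prop)).mul
      ((innerSL ℝ (e i)).continuous.comp_continuousOn hc)
  obtain ⟨c, hc1, hc2⟩ := exists_deriv_eq_slope z hT hzc fun t ht =>
    (hder t ht).differentiableAt.differentiableWithinAt
  rw [(hder c hc1).deriv, eq_comm, sub_zero, div_eq_zero_iff, or_iff_left hT.ne', sub_eq_zero] at hc2
  simp only [hz, mul_zero, Real.exp_zero, one_mul] at hc2
  rw [← hc2, ← mul_assoc, ← Real.exp_add]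
  simp

end Diagonal

/-! ### Duality between observation and control -/

section Duality

variable {H U : Type*} [NormedAddCommGroup H] [InnerProductSpace ℝ H] [CompleteSpace H]
  [NormedAddCommGroup U] [InnerProductSpace ℝ U] [CompleteSpace U]

/-- Lax–Milgram solves `(κ² G G* + ε²) y = S ψ`. The control `u = -κ² G* y` then leaves `S ψ + G u =
ε² y`. The energy `E = κ² ‖G* y‖² + ε² ‖y‖²` equals `⟪ψ, S y⟫`, which observability bounds by `‖ψ‖
√E`. So `E ≤ ‖ψ‖²`, and the two terms of `E` give the two estimates. -/
theorem exists_control_of_observability {S : H →L[ℝ] H} (hS : ∀ x y, ⟪S x, y⟫_ℝ = ⟪x, S y⟫_ℝ)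
    (G : U →L[ℝ] H) {κ ε : ℝ} (hκ : 0 ≤ κ) (hε : 0 < ε)
    (h : ∀ φ, ‖S φ‖ ^ 2 ≤ κ ^ 2 * ‖G.adjoint φ‖ ^ 2 + ε ^ 2 * ‖φ‖ ^ 2) (ψ : H) :
    ∃ u : U, ‖u‖ ≤ κ * ‖ψ‖ ∧ ‖S ψ + G u‖ ≤ ε * ‖ψ‖ := by
  let N : H →L[ℝ] H := (κ ^ 2) • (G ∘L G.adjoint) + (ε ^ 2) • ContinuousLinearMap.id ℝ H
  have hN : ∀ y, ⟪N y, y⟫_ℝ = κ ^ 2 * ‖G.adjoint y‖ ^ 2 + ε ^ 2 * ‖y‖ ^ 2 := fun y => by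
    change ⟪(κ ^ 2) • G (G.adjoint y) + (ε ^ 2) • y, y⟫_ℝ = _
    rw [inner_add_left, real_inner_smul_left, real_inner_smul_left,
      ← ContinuousLinearMap.adjoint_inner_right, real_inner_self_eq_norm_sq,
      real_inner_self_eq_norm_sq]
  have hco : IsCoercive ((innerSL ℝ) ∘L N) := by
    refine ⟨ε ^ 2, by positivity, fun y => ?_⟩
    change _ ≤ ⟪N y, y⟫_ℝ
    rw [hN, mul_assoc, ← sq]
    linarith [mul_nonneg (sq_nonneg κ) (sq_nonneg ‖G.adjoint y‖)]
  obtain ⟨y, hy⟩ := hco.continuousLinearEquivOfBilin.surjective (S ψ)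
  have hNy : N y = S ψ := by
    apply ext_inner_right ℝ
    intro w
    rw [← hy, hco.continuousLinearEquivOfBilin_apply]; rfl
  set E := κ ^ 2 * ‖G.adjoint y‖ ^ 2 + ε ^ 2 * ‖y‖ ^ 2 with hE
  have hE0 : 0 ≤ E := by positivity
  have h1 : E ≤ ‖ψ‖ * √E := by
    have h0 : E = ⟪ψ, S y⟫_ℝ := by rw [hE, ← hN, hNy, hS]
    refine h0.trans_le ((real_inner_le_norm _ _).trans ?_)
    gcongr
    exact Real.le_sqrt_of_sq_le (h y)
  have h2 : E ≤ ‖ψ‖ ^ 2 := by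
    have h3 : √E ≤ ‖ψ‖ := by
      rcases (Real.sqrt_nonneg E).eq_or_lt with h0 | h0
      · rw [← h0]; exact norm_nonneg _
      · refine le_of_mul_le_mul_right ?_ h0
        rwa [Real.mul_self_sqrt hE0]
    rw [← Real.sq_sqrt hE0]
    gcongr
  refine ⟨-(κ ^ 2 • G.adjoint y), ?_, ?_⟩
  · rw [norm_neg, norm_smul, Real.norm_of_nonneg (sq_nonneg κ), sq, mul_assoc]
    gcongr
    refine abs_le_of_sq_le_sq' ?_ (norm_nonneg _) |>.2
    rw [mul_pow]
    linarith [mul_nonneg (sq_nonneg ε) (sq_nonneg ‖y‖)]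
  · have : S ψ + G (-(κ ^ 2 • G.adjoint y)) = ε ^ 2 • y := by
      rw [← hNy, map_neg, map_smul]
      change (κ ^ 2) • G (G.adjoint y) + (ε ^ 2) • y + _ = _
      abel
    rw [this, norm_smul, Real.norm_of_nonneg (sq_nonneg ε), sq, mul_assoc]
    gcongr
    refine abs_le_of_sq_le_sq' ?_ (norm_nonneg _) |>.2
    rw [mul_pow]
    linarith [mul_nonneg (sq_nonneg κ) (sq_nonneg ‖G.adjoint y‖)]

/-- The kernel of the adjoint is the orthogonal complement of the range, so its triviality means
that the range is dense. -/
theorem exists_approx_preimage {G : U →L[ℝ] H} (h : ∀ φ, G.adjoint φ = 0 → φ = 0) (w : H) {ε : ℝ}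
    (hε : 0 < ε) : ∃ u, ‖G u - w‖ ≤ ε := by
  have htop : (LinearMap.range (G : U →ₗ[ℝ] H)).topologicalClosure = ⊤ := by
    rw [Submodule.topologicalClosure_eq_top_iff, eq_bot_iff]
    intro φ hφ
    refine h φ (ext_inner_left ℝ fun u => ?_)
    rw [ContinuousLinearMap.adjoint_inner_right, inner_zero_right]
    exact Submodule.mem_orthogonal _ _ |>.1 hφ _ ⟨u, rfl⟩
  have hw : w ∈ closure (LinearMap.range (G : U →ₗ[ℝ] H) : Set H) := by
    rw [← Submodule.topologicalClosure_coe, htop]; trivial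
  obtain ⟨_, ⟨u, rfl⟩, hu⟩ := Metric.mem_closure_iff.1 hw ε hε
  exact ⟨u, by rw [← dist_eq_norm, dist_comm]; exact hu.le⟩

end Duality

/-! ### Restriction to the control region -/

variable {ω : Set ℝ}

theorem memLp_restrict (hω : ω ⊆ Ioo a b) (u : L2 (Ioo a b)) :
    MemLp (u : ℝ → ℝ) 2 (volume.restrict ω) :=
  (Lp.memLp u).mono_measure (Measure.restrict_mono hω le_rfl)

theorem extendZero_ae_eq (hω : IsOpen ω) (h : L2 ω) :
    (extendZero a b hω h : ℝ → ℝ) =ᵐ[volume.restrict (Ioo a b)] ω.indicator h := by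
  unfold extendZero
  exact MemLp.coeFn_toLp _

theorem inner_extendZero (hω : IsOpen ω) (hsub : ω ⊆ Ioo a b) (h : L2 ω) (u : L2 (Ioo a b)) :
    ⟪extendZero a b hω h, u⟫_ℝ = ⟪h, (memLp_restrict hsub u).toLp _⟫_ℝ := by
  rw [L2.inner_def, L2.inner_def]
  have h1 : ∫ x in Ioo a b, ⟪extendZero a b hω h x, u x⟫_ℝ
      = ∫ x in Ioo a b, ω.indicator (fun x => ⟪h x, u x⟫_ℝ) x := by
    apply integral_congr_ae
    filter_upwards [extendZero_ae_eq hω h] with x hx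
    rw [hx]
    by_cases hxω : x ∈ ω <;> simp [hxω]
  rw [h1, setIntegral_indicator hω.measurableSet, inter_eq_right.2 hsub]
  apply integral_congr_ae
  filter_upwards [(memLp_restrict hsub u).coeFn_toLp] with x hx
  rw [hx]

/-- Restriction from `L²(a,b)` to `L²(ω)`. -/
def restrictL2 (hω : ω ⊆ Ioo a b) : L2 (Ioo a b) →L[ℝ] L2 ω :=
  LinearMap.mkContinuous
    { toFun := fun u => (memLp_restrict hω u).toLp _
      map_add' := fun u v => by
        rw [← MemLp.toLp_add]
        exact MemLp.toLp_congr _ _ (ae_restrict_of_ae_restrict_of_subset hω (Lp.coeFn_add u v))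
      map_smul' := fun c u => by
        rw [RingHom.id_apply, ← MemLp.toLp_const_smul]
        exact MemLp.toLp_congr _ _ (ae_restrict_of_ae_restrict_of_subset hω (Lp.coeFn_smul c u)) }
    1 (fun u => by
      rw [one_mul, Lp.norm_def u]
      refine (Lp.norm_toLp _ (memLp_restrict hω u)).trans_le ?_
      exact ENNReal.toReal_mono (Lp.memLp u).eLpNorm_ne_top
        (eLpNorm_mono_measure _ (Measure.restrict_mono hω le_rfl)))

theorem norm_sq_restrictL2 (hω : ω ⊆ Ioo a b) (u : L2 (Ioo a b)) :
    ‖restrictL2 hω u‖ ^ 2 = ∫ x in ω, (u x) ^ 2 := by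
  rw [← real_inner_self_eq_norm_sq, L2.inner_def]
  apply integral_congr_ae
  filter_upwards [(memLp_restrict hω u).coeFn_toLp] with x hx
  change ⟪(memLp_restrict hω u).toLp _ x, (memLp_restrict hω u).toLp _ x⟫_ℝ = _
  rw [hx, real_inner_self_eq_norm_sq, Real.norm_eq_abs, sq_abs]

/-- The impulse as a bounded linear map. -/
theorem exists_impulseCLM (hω : IsOpen ω) (hsub : ω ⊆ Ioo a b) :
    ∃ B : L2 ω →L[ℝ] State a b, (∀ h, B h = impulse a b hω h) ∧
      ∀ X : State a b, ‖B.adjoint X‖ ^ 2 = ∫ x in ω, (X.fst x) ^ 2 := by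
  -- Extension by zero is the adjoint of restriction; defining the map as an adjoint makes its own
  -- adjoint explicit.
  refine ⟨(restrictL2 hsub ∘L WithLp.fstL 2 ℝ (L2 (Ioo a b)) (EuclideanSpace ℝ (Fin 2))).adjoint,
    fun h => ?_, fun X => ?_⟩
  · apply ext_inner_right ℝ
    intro X
    rw [ContinuousLinearMap.adjoint_inner_left]
    refine (inner_extendZero hω hsub h X.fst).symm.trans ?_
    exact (inner_inlState _ X).symm
  · rw [ContinuousLinearMap.adjoint_adjoint]
    exact norm_sq_restrictL2 hsub X.fst

/-! ### Taylor polynomials and Lagrange interpolation -/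

/-- `F j` plays the role of the `j`-th derivative through the integral relation alone, which suits
representatives known only as primitives. The induction integrates the estimate for the shifted
sequence. -/
theorem abs_sub_taylor_le {a b : ℝ} (n : ℕ) : ∀ {F : ℕ → ℝ → ℝ} {M : ℝ},
    (∀ j, ContinuousOn (F j) (Icc a b)) →
    (∀ j, ∀ x ∈ Icc a b, F j x = F j a + ∫ s in a..x, F (j + 1) s) →
    (∀ x ∈ Icc a b, |F n x| ≤ M) → ∀ x ∈ Icc a b,
      |F 0 x - ∑ k ∈ Finset.range n, F k a / k.factorial * (x - a) ^ k|
        ≤ M * ((x - a) ^ n / n.factorial) := by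
  have hpow : ∀ (k : ℕ) (x : ℝ),
      ∫ s in a..x, (s - a) ^ k / k.factorial = (x - a) ^ (k + 1) / (k + 1).factorial := by
    intro k x
    rw [intervalIntegral.integral_div, intervalIntegral.integral_comp_sub_right (fun s => s ^ k) a,
      integral_pow, Nat.factorial_succ]
    push_cast
    rw [sub_self, zero_pow (by omega), sub_zero]
    field_simp
  induction n with
  | zero => intro F M _ _ hM x hx; simpa using hM x hx
  | succ n ih =>
    intro F M hF hrec hM x hx
    have h1 := @ih (fun j => F (j + 1)) M (fun j => hF _) (fun j => hrec _) hM
    have hsub : Icc a x ⊆ Icc a b := Icc_subset_Icc_right hx.2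
    have hFi : IntervalIntegrable (F 1) volume a x :=
      ContinuousOn.intervalIntegrable (by rw [uIcc_of_le hx.1]; exact (hF 1).mono hsub)
    have hTi : ∀ k, IntervalIntegrable
        (fun s => F (k + 1) a / k.factorial * (s - a) ^ k) volume a x :=
      fun k => Continuous.intervalIntegrable (by fun_prop) _ _
    have hTc : Continuous fun s => ∑ k ∈ Finset.range n, F (k + 1) a / k.factorial * (s - a) ^ k := by
      fun_prop
    have h2 : F 0 x - ∑ k ∈ Finset.range (n + 1), F k a / k.factorial * (x - a) ^ k
        = ∫ s in a..x,
          (F 1 s - ∑ k ∈ Finset.range n, F (k + 1) a / k.factorial * (s - a) ^ k) := by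
      rw [intervalIntegral.integral_sub hFi (hTc.intervalIntegrable _ _),
        intervalIntegral.integral_finsetSum fun k _ => hTi k, Finset.sum_range_succ', hrec 0 x hx]
      have h3 : ∀ k, ∫ s in a..x, F (k + 1) a / k.factorial * (s - a) ^ k
          = F (k + 1) a / (k + 1).factorial * (x - a) ^ (k + 1) := fun k => by
        have : ∀ s, F (k + 1) a / k.factorial * (s - a) ^ k
            = F (k + 1) a * ((s - a) ^ k / k.factorial) := fun s => by ring
        simp only [this]
        rw [intervalIntegral.integral_const_mul, hpow]; ring
      simp only [h3, zero_add, pow_zero, Nat.factorial_zero, Nat.cast_one, div_one, mul_one]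
      ring
    rw [h2, ← hpow, ← intervalIntegral.integral_const_mul]
    rw [← Real.norm_eq_abs]
    refine intervalIntegral.norm_integral_le_of_norm_le hx.1 (ae_of_all _ fun s hs => ?_)
      (Continuous.intervalIntegrable (by fun_prop) _ _)
    exact h1 s (hsub (Ioc_subset_Icc_self hs))

theorem prod_erase_dist {i n : ℕ} (h : i < n) :
    ∏ j ∈ (Finset.range n).erase i, |(i : ℝ) - j| = i.factorial * (n - 1 - i).factorial := by
  induction n, h using Nat.le_induction with
  | base =>
    have h1 : (Finset.range (i + 1)).erase i = Finset.range i := by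
      rw [Finset.range_add_one, Finset.erase_insert Finset.notMem_range_self]
    have h2 : ∀ j ∈ Finset.range i, |(i : ℝ) - j| = ((i - 1 - j + 1 : ℕ) : ℝ) := fun j hj => by
      have hj := Finset.mem_range.1 hj
      rw [abs_of_nonneg (sub_nonneg.2 (by exact_mod_cast hj.le)), ← Nat.cast_sub hj.le]
      congr 1; omega
    rw [h1, Finset.prod_congr rfl h2, ← Nat.cast_prod,
      Finset.prod_range_reflect (fun k => k + 1) i, Finset.prod_range_add_one_eq_factorial]
    simp
  | succ n hn ih =>
    have h1 : (Finset.range (n + 1)).erase i = insert n ((Finset.range n).erase i) := by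
      rw [Finset.range_add_one, Finset.erase_insert_of_ne (by omega)]
    rw [h1, Finset.prod_insert (by simp), ih]
    have h2 : n + 1 - 1 - i = (n - 1 - i) + 1 := by omega
    have hin : i ≤ n := by omega
    have h3 : |(i : ℝ) - n| = ((n - 1 - i + 1 : ℕ) : ℝ) := by
      rw [abs_sub_comm, abs_of_nonneg (sub_nonneg.2 (by exact_mod_cast hin)), ← Nat.cast_sub hin]
      congr 1
    rw [h2, h3, Nat.factorial_succ]
    push_cast
    ring

/-- Lagrange interpolation at separated nodes. The `i`-th basis polynomial is at most `(L / d)^N /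
(i! (N - i)!)` at `y`, and the sum over `i` of the binomial coefficients is `2^N`. -/
theorem abs_eval_le_of_separated {N : ℕ} {x : ℕ → ℝ} {d L s : ℝ} (hd : 0 < d)
    (hx : ∀ i j : ℕ, |(i : ℝ) - j| * d ≤ |x i - x j|) {p : Polynomial ℝ} (hp : p.degree < (N + 1 : ℕ))
    (hs : ∀ i < N + 1, |p.eval (x i)| ≤ s) {y : ℝ} (hy : ∀ i < N + 1, |y - x i| ≤ L) :
    |p.eval y| ≤ s * ((2 * L / d) ^ N / N.factorial) := by
  have hs0 : 0 ≤ s := (abs_nonneg _).trans (hs 0 (by omega))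
  have hL0 : 0 ≤ L := (abs_nonneg _).trans (hy 0 (by omega))
  have hne : ∀ i j : ℕ, i ≠ j → 0 < |(i : ℝ) - j| * d := fun i j hij =>
    mul_pos (abs_pos.2 (sub_ne_zero.2 (by exact_mod_cast hij))) hd
  have hinj : Set.InjOn x (Finset.range (N + 1)) := fun i _ j _ hij => by
    by_contra hne'
    have := (hne i j hne').trans_le (hx i j)
    rw [hij, sub_self, abs_zero] at this
    exact lt_irrefl _ this
  have hbasis : ∀ i ∈ Finset.range (N + 1), |(Lagrange.basis (Finset.range (N + 1)) x i).eval y|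
      ≤ (L / d) ^ N / (i.factorial * (N - i).factorial) := fun i hi => by
    have hi' := Finset.mem_range.1 hi
    rw [Lagrange.basis, Polynomial.eval_prod, Finset.abs_prod]
    have h1 : ∀ j ∈ (Finset.range (N + 1)).erase i,
        |(Lagrange.basisDivisor (x i) (x j)).eval y| ≤ (L / d) * |(i : ℝ) - j|⁻¹ := fun j hj => by
      have hj' := Finset.mem_erase.1 hj
      have hpos := hne i j hj'.1.symm
      rw [Lagrange.basisDivisor, Polynomial.eval_mul, Polynomial.eval_C, Polynomial.eval_sub,
        Polynomial.eval_X, Polynomial.eval_C, abs_mul, abs_inv]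
      calc |x i - x j|⁻¹ * |y - x j| ≤ (|(i : ℝ) - j| * d)⁻¹ * L := by
            gcongr
            · exact hx i j
            · exact hy j (Finset.mem_range.1 hj'.2)
        _ = _ := by rw [mul_inv]; ring
    refine (Finset.prod_le_prod (fun _ _ => abs_nonneg _) h1).trans (le_of_eq ?_)
    rw [Finset.prod_mul_distrib, Finset.prod_const, Finset.card_erase_of_mem hi, Finset.card_range,
      Finset.prod_inv_distrib, prod_erase_dist hi', Nat.add_sub_cancel, ← div_eq_mul_inv]
  rw [Lagrange.eq_interpolate hinj (f := p) (by rwa [Finset.card_range]), Lagrange.interpolate_apply,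
    Polynomial.eval_finsetSum]
  refine (Finset.abs_sum_le_sum_abs _ _).trans ?_
  calc ∑ i ∈ Finset.range (N + 1),
        |(Polynomial.C (p.eval (x i)) * Lagrange.basis (Finset.range (N + 1)) x i).eval y|
      ≤ ∑ i ∈ Finset.range (N + 1), s * ((L / d) ^ N / N.factorial * N.choose i) := by
        refine Finset.sum_le_sum fun i hi => ?_
        have hi' := Finset.mem_range.1 hi
        rw [Polynomial.eval_mul, Polynomial.eval_C, abs_mul]
        refine mul_le_mul (hs i hi') ((hbasis i hi).trans (le_of_eq ?_)) (abs_nonneg _) hs0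
        rw [Nat.cast_choose ℝ (by omega : i ≤ N)]
        field_simp
    _ = s * ((2 * L / d) ^ N / N.factorial) := by
        rw [← Finset.mul_sum, ← Finset.mul_sum]
        have : ∑ i ∈ Finset.range (N + 1), (N.choose i : ℝ) = 2 ^ N := by
          exact_mod_cast Nat.sum_range_choose N
        rw [this, mul_div_assoc 2 L d, mul_pow]; ring

theorem exists_sq_mul_le_integral_sq {f : ℝ → ℝ} {p q : ℝ} (hpq : p ≤ q)
    (hf : ContinuousOn f (Icc p q)) : ∃ x ∈ Icc p q, f x ^ 2 * (q - p) ≤ ∫ s in p..q, f s ^ 2 := by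
  obtain ⟨x, hx, hmin⟩ := isCompact_Icc.exists_isMinOn (nonempty_Icc.2 hpq) (hf.pow 2)
  refine ⟨x, hx, ?_⟩
  have := intervalIntegral.integral_mono_on hpq (μ := volume) (intervalIntegrable_const (c := f x ^ 2))
    (ContinuousOn.intervalIntegrable (by rw [uIcc_of_le hpq]; exact hf.pow 2)) fun y hy => hmin hy
  rw [intervalIntegral.integral_const, smul_eq_mul, mul_comm] at this
  exact this

/-- A continuous function close to a polynomial of degree less than `n` is controlled on `[a,b]` by
its `L²` norm on a subinterval. -/
theorem abs_le_of_near_polynomial {a b α β : ℝ} (hα : a ≤ α) (hαβ : α < β) (hβ : β ≤ b)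
    {f : ℝ → ℝ} (hf : ContinuousOn f (Icc a b)) {n : ℕ} (hn : 0 < n) {p : Polynomial ℝ}
    (hp : p.degree < n) {r : ℝ} (hr : ∀ x ∈ Icc a b, |f x - p.eval x| ≤ r) {I : ℝ}
    (hI : ∫ s in α..β, f s ^ 2 ≤ I) {y : ℝ} (hy : y ∈ Icc a b) :
    |f y| ≤ (√(2 * n / (β - α) * I) + r) * (4 * (b - a) / (β - α) * Real.exp 1) ^ n + r := by
  obtain ⟨N, rfl⟩ : ∃ N, n = N + 1 := ⟨n - 1, by omega⟩
  set l := β - α with hl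
  have hl0 : 0 < l := sub_pos.2 hαβ
  -- One node is taken in the left half of each of `n` equal cells; the unused right halves keep
  -- nodes `i` and `j` at distance at least `|i - j| h / 2`.
  set h := l / (N + 1 : ℕ) with hh
  have hN0 : (0 : ℝ) < (N + 1 : ℕ) := by positivity
  have hh0 : 0 < h := by positivity
  have hNh : (N + 1 : ℕ) * h = l := by rw [hh]; field_simp
  have hsub : ∀ i < N + 1, α ≤ α + i * h ∧ α + i * h + h / 2 ≤ β := fun i hi => by
    have h1 : (i : ℝ) + 1 ≤ (N + 1 : ℕ) := by exact_mod_cast hi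
    have h2 := mul_le_mul_of_nonneg_right h1 hh0.le
    constructor
    · linarith [mul_nonneg (Nat.cast_nonneg (α := ℝ) i) hh0.le]
    · linarith
  have hfi : IntervalIntegrable (fun s => f s ^ 2) volume α β :=
    ContinuousOn.intervalIntegrable
      (by rw [uIcc_of_le hαβ.le]; exact (hf.pow 2).mono (Icc_subset_Icc hα hβ))
  have hex : ∀ i : ℕ, ∃ x ∈ Icc (α + i * h) (α + i * h + h / 2),
      i < N + 1 → |f x| ≤ √(2 * (N + 1 : ℕ) / l * I) := fun i => by
    by_cases hi : i < N + 1
    · obtain ⟨h1, h2⟩ := hsub i hi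
      obtain ⟨x, hx, hx'⟩ := exists_sq_mul_le_integral_sq (f := f)
        (by linarith : α + i * h ≤ α + i * h + h / 2)
        (hf.mono (Icc_subset_Icc (by linarith) (by linarith)))
      refine ⟨x, hx, fun _ => Real.abs_le_sqrt ?_⟩
      have h3 : ∫ s in (α + i * h)..(α + i * h + h / 2), f s ^ 2 ≤ ∫ s in α..β, f s ^ 2 :=
        intervalIntegral.integral_mono_interval h1 (by linarith) h2
          (ae_of_all _ fun s => sq_nonneg (f s)) hfi
      have h4 : f x ^ 2 * (h / 2) ≤ I := by
        rw [show α + i * h + h / 2 - (α + i * h) = h / 2 by ring] at hx'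
        linarith
      calc f x ^ 2 = 2 * (N + 1 : ℕ) / l * (f x ^ 2 * (h / 2)) := by rw [hh]; field_simp
        _ ≤ _ := by gcongr
    -- Nodes beyond the last cell are dummies, present only because separation is required for all
    -- indices.
    · exact ⟨α + i * h, ⟨le_rfl, by linarith⟩, fun h => absurd h hi⟩
  choose x hx hfx using hex
  have hsep' : ∀ i j : ℕ, i < j → |(i : ℝ) - j| * (h / 2) ≤ |x i - x j| := fun i j hij => by
    have h1 : (i : ℝ) + 1 ≤ j := by exact_mod_cast hij
    rw [abs_sub_comm, abs_of_nonneg (by linarith), abs_sub_comm]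
    refine le_trans ?_ (le_abs_self _)
    have h2 := (hx i).2
    have h3 := (hx j).1
    have h4 := mul_le_mul_of_nonneg_right h1 hh0.le
    nlinarith
  have hsep : ∀ i j : ℕ, |(i : ℝ) - j| * (h / 2) ≤ |x i - x j| := fun i j => by
    rcases lt_trichotomy i j with hij | rfl | hij
    · exact hsep' i j hij
    · simp
    · rw [abs_sub_comm, abs_sub_comm (x i)]; exact hsep' j i hij
  have hxm : ∀ i < N + 1, x i ∈ Icc a b := fun i hi =>
    ⟨by linarith [(hx i).1, (hsub i hi).1], by linarith [(hx i).2, (hsub i hi).2]⟩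
  have hr0 : 0 ≤ r := (abs_nonneg _).trans (hr y hy)
  have key := abs_eval_le_of_separated (N := N) (x := x) (d := h / 2) (L := b - a)
    (s := √(2 * (N + 1 : ℕ) / l * I) + r) (by positivity) hsep (p := p) hp
    (fun i hi => by
      have h1 := hr (x i) (hxm i hi)
      have h2 := hfx i hi
      rw [abs_sub_comm] at h1
      linarith [abs_sub_abs_le_abs_sub (p.eval (x i)) (f (x i))])
    (y := y) (fun i hi => by
      have := hxm i hi
      rw [abs_le]
      exact ⟨by linarith [hy.1, this.2], by linarith [hy.2, this.1]⟩)
  -- As `(N + 1)^N / N! ≤ exp(N + 1)`, the factorial compensates for the shrinking spacing and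
  -- leaves geometric growth.
  have hgrow : (2 * (b - a) / (h / 2)) ^ N / N.factorial
      ≤ (4 * (b - a) / l * Real.exp 1) ^ (N + 1) := by
    have h1 := Real.pow_div_factorial_le_exp (x := (N + 1 : ℕ)) (Nat.cast_nonneg _) N
    have h2 : 1 ≤ 4 * (b - a) / l := by rw [le_div_iff₀ hl0]; linarith
    calc (2 * (b - a) / (h / 2)) ^ N / N.factorial
        = (4 * (b - a) / l) ^ N * (((N + 1 : ℕ) : ℝ) ^ N / N.factorial) := by
          rw [hh, ← mul_div_assoc, ← mul_pow]; congr 2; field_simp; ring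
      _ ≤ (4 * (b - a) / l) ^ (N + 1) * Real.exp ((N + 1 : ℕ) : ℝ) := by
          refine mul_le_mul (pow_le_pow_right₀ h2 (by omega)) h1 (by positivity) (by positivity)
      _ = _ := by rw [mul_pow, ← Real.exp_nat_mul, mul_one]
  have h5 : |p.eval y| ≤ (√(2 * (N + 1 : ℕ) / l * I) + r)
      * (4 * (b - a) / l * Real.exp 1) ^ (N + 1) := key.trans (by gcongr)
  linarith [abs_sub_abs_le_abs_sub (f y) (p.eval y), hr y hy]

/-! ### The spectral inequality -/

/-- With `n = 2m` and `z = exp(γ + 1) X L`, the bound `z^n / n! ≤ exp z` controls the product by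
`exp(Q + 2X + z - n)`, and `n ≥ A X + Q` makes the exponent nonpositive. The factor `exp(γ n)`
stands for the interpolation loss; `n` is even because each application of `A` costs two
derivatives. -/
theorem exists_nat_exp_bound {A Q L γ : ℝ} (hA : 0 ≤ A) (hQ : 0 ≤ Q) (hL : 0 ≤ L)
    (hAL : Real.exp (γ + 1) * L + 2 ≤ A) {X : ℝ} (hX : 0 ≤ X) :
    ∃ m : ℕ, 0 < m ∧ ((2 * m : ℕ) : ℝ) ≤ 2 * (A * X + Q + 2) ∧
      Q * (1 + X ^ 2) * ((X * L) ^ (2 * m) / (2 * m).factorial) * Real.exp γ ^ (2 * m) ≤ 1 := by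
  refine ⟨⌈A * X + Q⌉₊ + 1, Nat.succ_pos _, ?_, ?_⟩
  · have := (Nat.ceil_lt_add_one (by positivity : 0 ≤ A * X + Q)).le
    push_cast; linarith
  set n := 2 * (⌈A * X + Q⌉₊ + 1) with hn
  have hn' : A * X + Q ≤ n := by
    have := Nat.le_ceil (A * X + Q)
    have h0 : (0 : ℝ) ≤ (⌈A * X + Q⌉₊ : ℝ) := Nat.cast_nonneg _
    rw [hn]; push_cast; linarith
  have h1 : (X * L) ^ n / n.factorial * Real.exp γ ^ n
      ≤ Real.exp (Real.exp (γ + 1) * (X * L) - n) := by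
    have := Real.pow_div_factorial_le_exp (x := Real.exp (γ + 1) * (X * L)) (by positivity) n
    rw [Real.exp_sub, le_div_iff₀ (Real.exp_pos _)]
    refine le_trans (le_of_eq ?_) this
    have h0 : Real.exp (n : ℝ) = Real.exp 1 ^ n := by rw [← Real.exp_nat_mul, mul_one]
    rw [h0, Real.exp_add]
    ring
  have h2 : 1 + X ^ 2 ≤ Real.exp (2 * X) := by
    have := Real.quadratic_le_exp_of_nonneg (x := 2 * X) (by positivity)
    nlinarith
  have h3 : Q ≤ Real.exp Q := by linarith [Real.add_one_le_exp Q]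
  calc Q * (1 + X ^ 2) * ((X * L) ^ n / n.factorial) * Real.exp γ ^ n
      = Q * (1 + X ^ 2) * ((X * L) ^ n / n.factorial * Real.exp γ ^ n) := by ring
    _ ≤ Real.exp Q * Real.exp (2 * X) * Real.exp (Real.exp (γ + 1) * (X * L) - n) := by gcongr
    _ = Real.exp (Q + 2 * X + (Real.exp (γ + 1) * (X * L) - n)) := by
        rw [← Real.exp_add, ← Real.exp_add]
    _ ≤ 1 := by
        rw [Real.exp_le_one_iff]
        linarith [mul_le_mul_of_nonneg_right hAL hX]

/-- A sequence of iterates of the heat operator with geometric growth is close to a polynomial. -/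
theorem exists_near_polynomial (hab : a < b) {U : ℕ → State a b}
    (hU : ∀ k, IsHeatOperator (U k) (U (k + 1))) {Λ M : ℝ} (hΛ : 0 ≤ Λ)
    (hM : ∀ k, ‖U k‖ ≤ Λ ^ k * M) :
    ∃ f : ℝ → ℝ, ContinuousOn f (Icc a b) ∧
      ((U 0).fst : ℝ → ℝ) =ᵐ[volume.restrict (Ioo a b)] f ∧
      (U 0).snd 0 = f a ∧ (U 0).snd 1 = f b ∧
      ∀ m : ℕ, ∃ p : Polynomial ℝ, p.degree < (2 * m : ℕ) ∧ ∀ x ∈ Icc a b,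
        |f x - p.eval x| ≤ (1 + (b - a) * (1 + √(b - a))) * (1 + Λ) * M *
          ((√Λ * (b - a)) ^ (2 * m) / (2 * m).factorial) := by
  choose f g hf hfr hgr hfc hgc hU1 _ using fun k => (hU k).exists_repr hab
  have ham : a ∈ Icc a b := left_mem_Icc.2 hab.le
  have hM0 : 0 ≤ M := by simpa using (norm_nonneg _).trans (hM 0)
  have hLpos : 0 < b - a := sub_pos.2 hab
  have hfa : ∀ k, f k a = (U k).snd 0 := fun k => by simp [hfr k a ham]
  have hga : ∀ k, g k a = (U (k + 1)).snd 0 := fun k => by simp [hgr k a ham]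
  have hgb : ∀ k, ∀ x ∈ Icc a b, |g k x| ≤ (1 + √(b - a)) * ‖U (k + 1)‖ := fun k x hx => by
    rw [hgr k x hx]
    refine (abs_add_le _ _).trans ?_
    have h1 := abs_integral_le_sqrt_mul_norm (U (k + 1)).fst hx.1 le_rfl hx.2
    have h2 : √(x - a) * ‖(U (k + 1)).fst‖ ≤ √(b - a) * ‖U (k + 1)‖ := by
      gcongr
      · exact hx.2
      · exact norm_fst_le _
    linarith [abs_snd_zero_le (U (k + 1))]
  -- A representative is its value at `a` plus the integral of its derivative, which is controlled
  -- by the next iterate; the factor `1 + Λ` pays for that extra iterate.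
  have hfb : ∀ k, ∀ x ∈ Icc a b,
      |f k x| ≤ (1 + (b - a) * (1 + √(b - a))) * (1 + Λ) * M * Λ ^ k := fun k x hx => by
    rw [hfr k x hx]
    refine (abs_add_le _ _).trans ?_
    have h1 : |∫ s in a..x, g k s| ≤ ((1 + √(b - a)) * ‖U (k + 1)‖) * (b - a) := by
      rw [← Real.norm_eq_abs]
      refine (intervalIntegral.norm_integral_le_of_norm_le_const
        (C := (1 + √(b - a)) * ‖U (k + 1)‖) fun s hs => ?_).trans ?_
      · rw [uIoc_of_le hx.1] at hs
        exact hgb k s ⟨hs.1.le, hs.2.trans hx.2⟩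
      · rw [abs_of_nonneg (sub_nonneg.2 hx.1)]
        gcongr
        exact hx.2
    have h2 := abs_snd_zero_le (U k)
    have h3 := hM k
    have h4 : ((1 + √(b - a)) * ‖U (k + 1)‖) * (b - a)
        ≤ ((1 + √(b - a)) * (Λ ^ (k + 1) * M)) * (b - a) := by
      gcongr; exact hM (k + 1)
    have h5 : (1 + (b - a) * (1 + √(b - a))) * (1 + Λ) * M * Λ ^ k
        = Λ ^ k * M + ((1 + √(b - a)) * (Λ ^ (k + 1) * M)) * (b - a)
          + (Λ * (Λ ^ k * M) + (b - a) * (1 + √(b - a)) * (M * Λ ^ k)) := by ring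
    have h6 : 0 ≤ Λ * (Λ ^ k * M) + (b - a) * (1 + √(b - a)) * (M * Λ ^ k) := by positivity
    linarith
  refine ⟨f 0, hfc 0, hf 0, (hfa 0).symm, hU1 0, fun m => ?_⟩
  -- Interleaving representatives of the iterates with their first derivatives lists all successive
  -- derivatives of `f 0`.
  let F : ℕ → ℝ → ℝ := fun n => if n % 2 = 0 then f (n / 2) else g (n / 2)
  have hF0 : ∀ k, F (2 * k) = f k := fun k => by simp [F]
  have hF1 : ∀ k, F (2 * k + 1) = g k := fun k => by
    simp only [F]; rw [if_neg (by omega)]; congr 1; omega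
  have hcases : ∀ n : ℕ, ∃ k, n = 2 * k ∨ n = 2 * k + 1 := fun n => ⟨n / 2, by omega⟩
  have hFc : ∀ n, ContinuousOn (F n) (Icc a b) := fun n => by
    obtain ⟨k, rfl | rfl⟩ := hcases n
    · rw [hF0]; exact hfc k
    · rw [hF1]; exact hgc k
  have hFr : ∀ n, ∀ x ∈ Icc a b, F n x = F n a + ∫ s in a..x, F (n + 1) s := fun n x hx => by
    obtain ⟨k, rfl | rfl⟩ := hcases n
    · rw [hF0, hF1, hfa, hfr k x hx]
    · rw [hF1, show 2 * k + 1 + 1 = 2 * (k + 1) by ring, hF0, hga, hgr k x hx]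
      congr 1
      rw [← setIntegral_Ioo_eq hx.1, ← setIntegral_Ioo_eq hx.1]
      exact integral_congr_ae (ae_restrict_of_ae_restrict_of_subset (Ioo_subset_Ioo_right hx.2)
        (hf (k + 1)))
  refine ⟨∑ k ∈ Finset.range (2 * m), Polynomial.C (F k a / k.factorial) *
    (Polynomial.X - Polynomial.C a) ^ k, ?_, fun x hx => ?_⟩
  · refine (Polynomial.degree_sum_le _ _).trans_lt ?_
    rw [Finset.sup_lt_iff (WithBot.bot_lt_coe _)]
    intro k hk
    rw [← Polynomial.smul_eq_C_mul]
    refine (Polynomial.degree_smul_le _ _).trans_lt ?_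
    rw [Polynomial.degree_pow, Polynomial.degree_X_sub_C]
    rw [nsmul_one]
    exact_mod_cast Finset.mem_range.1 hk
  · have := abs_sub_taylor_le (2 * m) hFc hFr (fun x hx => by rw [hF0]; exact hfb m x hx) x hx
    rw [show F 0 = f 0 from hF0 0] at this
    rw [Polynomial.eval_finsetSum]
    simp only [Polynomial.eval_mul, Polynomial.eval_C, Polynomial.eval_pow, Polynomial.eval_sub,
      Polynomial.eval_X]
    refine this.trans ?_
    have h1 : √Λ ^ (2 * m) = Λ ^ m := by rw [pow_mul, Real.sq_sqrt hΛ]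
    rw [mul_pow, h1]
    have h2 : (x - a) ^ (2 * m) ≤ (b - a) ^ (2 * m) :=
      pow_le_pow_left₀ (sub_nonneg.2 hx.1) (by linarith [hx.2]) _
    calc _ = (1 + (b - a) * (1 + √(b - a))) * (1 + Λ) * M * Λ ^ m / (2 * m).factorial
          * (x - a) ^ (2 * m) := by ring
      _ ≤ (1 + (b - a) * (1 + √(b - a))) * (1 + Λ) * M * Λ ^ m / (2 * m).factorial
          * (b - a) ^ (2 * m) := by gcongr
      _ = _ := by ring

/-- The number `b - a + 2` is the total mass of Lebesgue measure plus the two boundary points. -/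
theorem norm_state_le_of_bound (hab : a ≤ b) {X : State a b} {f : ℝ → ℝ} {C : ℝ}
    (hX : (X.fst : ℝ → ℝ) =ᵐ[volume.restrict (Ioo a b)] f) (h0 : X.snd 0 = f a)
    (h1 : X.snd 1 = f b) (hC : ∀ x ∈ Icc a b, |f x| ≤ C) : ‖X‖ ≤ √(b - a + 2) * C := by
  have hC0 : 0 ≤ C := (abs_nonneg _).trans (hC a (left_mem_Icc.2 hab))
  refine abs_le_of_sq_le_sq' ?_ (by positivity) |>.2
  have h2 := norm_L2_le_of_bound hab X.fst hC0 (by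
    filter_upwards [hX, ae_restrict_mem measurableSet_Ioo] with x hx hx'
    rw [hx]; exact hC x (Ioo_subset_Icc_self hx'))
  have h3 := pow_le_pow_left₀ (norm_nonneg _) h2 2
  rw [mul_pow, Real.sq_sqrt (by linarith)] at h3
  have h4 : f a ^ 2 ≤ C ^ 2 := sq_le_sq' (abs_le.1 (hC a (left_mem_Icc.2 hab))).1
    (abs_le.1 (hC a (left_mem_Icc.2 hab))).2
  have h5 : f b ^ 2 ≤ C ^ 2 := sq_le_sq' (abs_le.1 (hC b (right_mem_Icc.2 hab))).1
    (abs_le.1 (hC b (right_mem_Icc.2 hab))).2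
  rw [norm_sq_state_eq, h0, h1, mul_pow, Real.sq_sqrt (by linarith)]
  linarith

/-- The growth hypothesis is how a spectrum inside `[0,Λ]` enters. Approximation by a polynomial of
degree of order `√Λ` and interpolation from an interval inside `ω` bound `U 0` by its observation
times a factor exponential in `√Λ`, plus a remainder absorbed on the left. -/
theorem exists_spectral_inequality (hab : a < b) (hω : IsOpen ω) (hne : ω.Nonempty)
    (hsub : ω ⊆ Ioo a b) : ∃ C₁ C₂ : ℝ, 0 < C₁ ∧ 0 < C₂ ∧ ∀ (Λ : ℝ) (U : ℕ → State a b), 0 ≤ Λ →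
      (∀ k, IsHeatOperator (U k) (U (k + 1))) → (∀ k, ‖U k‖ ≤ Λ ^ k * ‖U 0‖) →
      ‖U 0‖ ≤ C₁ * Real.exp (C₂ * √Λ) * √(∫ x in ω, ((U 0).fst x) ^ 2) := by
  obtain ⟨x₀, hx₀⟩ := hne
  obtain ⟨δ, hδ, hball⟩ := Metric.isOpen_iff.1 hω x₀ hx₀
  rw [Real.ball_eq_Ioo] at hball
  have hαβ : x₀ - δ < x₀ + δ := by linarith
  obtain ⟨hα, hβ⟩ := (Ioo_subset_Ioo_iff hαβ).1 (hball.trans hsub)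
  set l := x₀ + δ - (x₀ - δ) with hl
  have hl0 : 0 < l := sub_pos.2 hαβ
  set L := b - a with hL
  have hL0 : 0 < L := sub_pos.2 hab
  have hlL : l ≤ L := by linarith
  set γ := Real.log (4 * L / l * Real.exp 1) with hγ
  have hD1 : 1 ≤ 4 * L / l * Real.exp 1 := by
    have h1 : 1 ≤ 4 * L / l := by rw [le_div_iff₀ hl0]; linarith
    have h2 : 1 ≤ Real.exp 1 := Real.one_le_exp zero_le_one
    nlinarith
  have hγ0 : 0 ≤ γ := Real.log_nonneg hD1
  have hexpγ : Real.exp γ = 4 * L / l * Real.exp 1 := Real.exp_log (by linarith)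
  set C₀ := 1 + L * (1 + √L) with hC₀
  have hC₀pos : 0 < C₀ := by positivity
  set D := √(L + 2) with hD
  have hDpos : 0 < D := Real.sqrt_pos.2 (by linarith)
  -- This `Q` forces `4 D r Γ ≤ ‖U 0‖` below, so the two remainder terms together cost at most half
  -- of `‖U 0‖`.
  set Q := 4 * D * C₀ with hQ
  set A := Real.exp (γ + 1) * L + 2 with hA
  -- The rate per degree: `γ` from interpolation, `2 / l` from bounding the square root of `2 n / l`
  -- by an exponential.
  set μ := γ + 2 / l with hμ
  have hμ0 : 0 < μ := by positivity
  refine ⟨2 * D * Real.exp (μ * (2 * (Q + 2))), μ * (2 * A), by positivity, by positivity,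
    fun Λ U hΛ hU hM => ?_⟩
  set M := ‖U 0‖ with hMdef
  obtain ⟨f, hfc, hf, hf0, hf1, hpoly⟩ := exists_near_polynomial hab hU hΛ hM
  obtain ⟨m, hm, hmle, hmsmall⟩ := exists_nat_exp_bound (A := A) (Q := Q) (L := L) (γ := γ)
    (by positivity) (by positivity) hL0.le le_rfl (Real.sqrt_nonneg Λ)
  rw [Real.sq_sqrt hΛ] at hmsmall
  obtain ⟨p, hp, hfp⟩ := hpoly m
  set I := ∫ x in ω, ((U 0).fst x) ^ 2 with hI
  have hI0 : 0 ≤ I := integral_nonneg fun x => sq_nonneg _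
  have hfI : ∫ s in (x₀ - δ)..(x₀ + δ), f s ^ 2 ≤ I := by
    have h1 : ∫ s in (x₀ - δ)..(x₀ + δ), f s ^ 2
        = ∫ x in Ioo (x₀ - δ) (x₀ + δ), ((U 0).fst x) ^ 2 := by
      rw [← setIntegral_Ioo_eq hαβ.le]
      apply integral_congr_ae
      filter_upwards [ae_restrict_of_ae_restrict_of_subset (hball.trans hsub) hf] with x hx
      rw [hx]
    rw [h1]
    exact setIntegral_mono_set ((memLp_restrict hsub (U 0).fst).integrable_sq)
      (ae_of_all _ fun x => sq_nonneg _) hball.eventuallyLE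
  set r := C₀ * (1 + Λ) * M * ((√Λ * L) ^ (2 * m) / (2 * m).factorial) with hr
  have hM0 : 0 ≤ M := norm_nonneg _
  have hr0 : 0 ≤ r := by positivity
  set Γ := Real.exp γ ^ (2 * m) with hΓ
  have hΓ1 : 1 ≤ Γ := one_le_pow₀ (Real.one_le_exp hγ0)
  have hsup : ∀ y ∈ Icc a b, |f y| ≤ (√(2 * (2 * m : ℕ) / l * I) + r) * Γ + r := fun y hy => by
    rw [hΓ, hexpγ]
    exact abs_le_of_near_polynomial hα hαβ hβ hfc (by omega) hp hfp hfI hy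
  have h1 := norm_state_le_of_bound hab.le hf hf0 hf1 hsup
  have h2 : 4 * D * (r * Γ) ≤ M := by
    calc 4 * D * (r * Γ)
        = Q * (1 + Λ) * ((√Λ * L) ^ (2 * m) / (2 * m).factorial) * Real.exp γ ^ (2 * m) * M := by
          rw [hQ, hr, hΓ]; ring
      _ ≤ 1 * M := by gcongr
      _ = M := one_mul M
  have h3 : D * ((√(2 * (2 * m : ℕ) / l * I) + r) * Γ + r)
      ≤ D * (√(2 * (2 * m : ℕ) / l * I) * Γ) + M / 2 := by
    have : D * r ≤ D * (r * Γ) := by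
      gcongr; exact le_mul_of_one_le_right hr0 hΓ1
    linarith
  have h4 : √(2 * (2 * m : ℕ) / l * I) ≤ Real.exp (2 * (2 * m : ℕ) / l) * √I := by
    rw [Real.sqrt_mul (by positivity)]
    gcongr
    have h5 : 0 ≤ 2 * ((2 * m : ℕ) : ℝ) / l := by positivity
    have h6 := Real.add_one_le_exp (2 * ((2 * m : ℕ) : ℝ) / l)
    refine Real.sqrt_le_iff.2 ⟨(Real.exp_pos _).le, ?_⟩
    nlinarith
  have h5 : Real.exp (2 * (2 * m : ℕ) / l) * Γ
      ≤ Real.exp (μ * (2 * (Q + 2))) * Real.exp (μ * (2 * A) * √Λ) := by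
    rw [hΓ, ← Real.exp_nat_mul, ← Real.exp_add, ← Real.exp_add, Real.exp_le_exp]
    have h6 := mul_le_mul_of_nonneg_left hmle hμ0.le
    have h7 : 2 * ((2 * m : ℕ) : ℝ) / l + (2 * m : ℕ) * γ = μ * (2 * m : ℕ) := by
      rw [hμ]; ring
    rw [h7]
    linarith
  have h6 : D * (√(2 * (2 * m : ℕ) / l * I) * Γ)
      ≤ D * (Real.exp (μ * (2 * (Q + 2))) * Real.exp (μ * (2 * A) * √Λ) * √I) := by
    have : √(2 * (2 * m : ℕ) / l * I) * Γ ≤ Real.exp (2 * (2 * m : ℕ) / l) * Γ * √I := by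
      calc _ ≤ Real.exp (2 * (2 * m : ℕ) / l) * √I * Γ := by gcongr
        _ = _ := by ring
    have h8 := this.trans (mul_le_mul_of_nonneg_right h5 (Real.sqrt_nonneg I))
    exact mul_le_mul_of_nonneg_left h8 hDpos.le
  calc M ≤ 2 * (D * (Real.exp (μ * (2 * (Q + 2))) * Real.exp (μ * (2 * A) * √Λ) * √I)) := by
        linarith
    _ = _ := by ring

/-! ### The heat semigroup -/

/-- `S` is the semigroup generated by the heat operator with dynamic boundary conditions. -/
structure IsHeatSemigroup (S : ℝ → State a b →L[ℝ] State a b) : Prop where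
  zero : ∀ x, S 0 x = x
  symm : ∀ t, 0 ≤ t → ∀ x y, ⟪S t x, y⟫_ℝ = ⟪x, S t y⟫_ℝ
  norm_le : ∀ t, 0 ≤ t → ∀ x, ‖S t x‖ ≤ ‖x‖
  injective : ∀ t, 0 ≤ t → ∀ x, S t x = 0 → x = 0
  continuous : ∀ x, Continuous fun t => S t x
  equation : ∀ t, 0 < t → ∀ x, ∃ V, IsHeatOperator (S t x) V ∧ HasDerivAt (fun s => S s x) V t
  unique : ∀ T, 0 < T → ∀ ϑ, IsHeatSolution T ϑ → ϑ T = S T (ϑ 0)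

theorem isHeatSemigroup_of_diagonal {ι : Type*} (e : HilbertBasis ι ℝ (State a b)) {lam : ι → ℝ}
    (hlam : ∀ i, 0 ≤ lam i)
    (hop : ∀ U V : State a b, IsHeatOperator U V ↔ ∀ i, ⟪e i, V⟫_ℝ = -lam i * ⟪e i, U⟫_ℝ)
    {S : ℝ → State a b →L[ℝ] State a b}
    (hS : ∀ t, 0 ≤ t → ∀ i x, ⟪e i, S t x⟫_ℝ = Real.exp (-lam i * t) * ⟪e i, x⟫_ℝ)
    (hcont : ∀ x, Continuous fun t => S t x)
    (hder : ∀ t, 0 < t → ∀ x, ∃ V, (∀ i, ⟪e i, V⟫_ℝ = -lam i * ⟪e i, S t x⟫_ℝ) ∧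
        HasDerivAt (fun s => S s x) V t) : IsHeatSemigroup S where
  zero x := hilbertBasis_ext e fun i => by rw [hS 0 le_rfl]; simp
  symm t ht x y := by
    rw [← e.tsum_inner_mul_inner, ← e.tsum_inner_mul_inner]
    congr 1
    ext i
    rw [hS t ht, real_inner_comm, hS t ht, real_inner_comm x]
    ring
  norm_le t ht x := by
    rw [← one_mul ‖x‖]
    refine norm_le_of_inner_le e zero_le_one fun i => ?_
    rw [hS t ht, abs_mul, abs_of_pos (Real.exp_pos _)]
    gcongr
    rw [Real.exp_le_one_iff]
    nlinarith [mul_nonneg (hlam i) ht]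
  injective t ht x hx := hilbertBasis_ext e fun i => by
    have := hS t ht i x
    rw [hx, inner_zero_right] at this
    rw [inner_zero_right]
    exact (mul_eq_zero.1 this.symm).resolve_left (Real.exp_ne_zero _)
  continuous := hcont
  equation t ht x := by
    obtain ⟨V, h1, h2⟩ := hder t ht x
    exact ⟨V, (hop _ _).2 h1, h2⟩
  unique T hT ϑ hϑ := hilbertBasis_ext e fun i => by
    rw [hS T hT.le]
    refine eq_semigroup_of_hasDerivAt e hϑ.continuousOn (fun t ht => ?_) hT i
    obtain ⟨V, h1, h2⟩ := hϑ.equation t ht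
    exact ⟨V, (hop _ _).1 h1, h2⟩

/-! ### Observability -/

/-- With `l = log(2C / ε)` and `X = c / T + √(l / T)`, one has `c X - X² T = -c √(l / T) - l ≤ -l`.
The cost follows from `√(l / T) ≤ l + 1 / T`, whose two terms produce the power of `1 / ε` and the
exponential of `1 / T`. -/
theorem exists_frequency {C c T ε : ℝ} (hC : 1 ≤ C) (hc : 0 < c) (hT : 0 < T) (hε : 0 < ε)
    (hε1 : ε < 1) : ∃ X : ℝ, 0 ≤ X ∧ C * Real.exp (c * X) * Real.exp (-X ^ 2 * T) ≤ ε / 2 ∧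
      2 * (C * Real.exp (c * X))
        ≤ 2 * C * (2 * C) ^ c * Real.exp ((c ^ 2 + c) / T) / ε ^ c := by
  set l := Real.log (2 * C / ε) with hl
  have hpos : 0 < 2 * C / ε := by positivity
  have hl0 : 0 < l := Real.log_pos (by rw [lt_div_iff₀ hε]; linarith)
  have hexp : Real.exp l = 2 * C / ε := Real.exp_log hpos
  set X := c / T + √(l / T) with hX
  have hs0 : 0 ≤ √(l / T) := Real.sqrt_nonneg _
  have hs2 : √(l / T) ^ 2 = l / T := Real.sq_sqrt (by positivity)
  refine ⟨X, by positivity, ?_, ?_⟩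
  · have h1 : c * X + -X ^ 2 * T ≤ -l := by
      have h2 : c * X + -X ^ 2 * T = -(c / T * √(l / T) * T) - √(l / T) ^ 2 * T := by
        rw [hX]; field_simp; ring
      rw [h2, hs2, div_mul_cancel₀ _ hT.ne']
      have : 0 ≤ c / T * √(l / T) * T := by positivity
      linarith
    rw [mul_assoc, ← Real.exp_add]
    calc C * Real.exp (c * X + -X ^ 2 * T) ≤ C * Real.exp (-l) := by gcongr
      _ = ε / 2 := by rw [Real.exp_neg, hexp]; field_simp
  · have h1 : √(l / T) ≤ l + 1 / T := by
      refine Real.sqrt_le_iff.2 ⟨by positivity, ?_⟩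
      have : l / T = l * (1 / T) := by ring
      rw [this]
      nlinarith [mul_pos hl0 (one_div_pos.2 hT), sq_nonneg l, sq_nonneg (1 / T)]
    have h2 : c * X ≤ (c ^ 2 + c) / T + l * c := by
      have : (c ^ 2 + c) / T + l * c = c * (c / T + (l + 1 / T)) := by field_simp; ring
      rw [this, hX]
      gcongr
    have h3 : Real.exp (l * c) = (2 * C) ^ c / ε ^ c := by
      rw [Real.exp_mul, hexp, Real.div_rpow (by positivity) hε.le]
    calc 2 * (C * Real.exp (c * X))
        ≤ 2 * (C * Real.exp ((c ^ 2 + c) / T + l * c)) := by gcongr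
      _ = _ := by rw [Real.exp_add, h3]; ring

theorem exists_observability {ι : Type*} (e : HilbertBasis ι ℝ (State a b)) {lam : ι → ℝ}
    (hlam : ∀ i, 0 ≤ lam i)
    (hop : ∀ U V : State a b, IsHeatOperator U V ↔ ∀ i, ⟪e i, V⟫_ℝ = -lam i * ⟪e i, U⟫_ℝ)
    {S : ℝ → State a b →L[ℝ] State a b}
    (hS : ∀ t, 0 ≤ t → ∀ i x, ⟪e i, S t x⟫_ℝ = Real.exp (-lam i * t) * ⟪e i, x⟫_ℝ)
    (hsemi : IsHeatSemigroup S)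
    (hab : a < b) (hω : IsOpen ω) (hne : ω.Nonempty) (hsub : ω ⊆ Ioo a b) :
    ∃ M₁ M₂ δ : ℝ, 0 < M₁ ∧ 0 < M₂ ∧ 0 < δ ∧ ∀ T : ℝ, 0 < T → ∀ ε : ℝ, 0 < ε → ∀ x,
      ‖S T x‖ ^ 2 ≤ (M₁ * Real.exp (M₂ / T) / ε ^ δ) ^ 2 * (∫ y in ω, ((S T x).fst y) ^ 2)
          + ε ^ 2 * ‖x‖ ^ 2 := by
  obtain ⟨C₁, c, hC₁, hc, hspec⟩ := exists_spectral_inequality hab hω hne hsub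
  -- The added one pays for the high-frequency part of the state itself and ensures `C ≥ 1`.
  set C := C₁ + 1 with hC
  refine ⟨2 * C * (2 * C) ^ c, c ^ 2 + c, c, by positivity, by positivity, hc,
    fun T hT ε hε x => ?_⟩
  have hint : 0 ≤ ∫ y in ω, ((S T x).fst y) ^ 2 := integral_nonneg fun y => sq_nonneg _
  rcases le_or_gt 1 ε with hε1 | hε1
  · have h1 : ‖S T x‖ ^ 2 ≤ 1 * ‖x‖ ^ 2 := by
      rw [one_mul]; exact pow_le_pow_left₀ (norm_nonneg _) (hsemi.norm_le T hT.le x) 2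
    have h2 : 1 * ‖x‖ ^ 2 ≤ ε ^ 2 * ‖x‖ ^ 2 := by gcongr; exact one_le_pow₀ hε1
    exact (h1.trans h2).trans (le_add_of_nonneg_left (by positivity))
  obtain ⟨X, hX, hsmall, hcost⟩ := exists_frequency (C := C) (by linarith) hc hT hε hε1
  -- The multiplier of `A^k` truncated to frequencies at most `X²`: `D 0` is the low-frequency
  -- projection and `D k` its iterates under `A`.
  have hm : ∀ (k : ℕ) i, |if lam i ≤ X ^ 2 then (-lam i) ^ k else 0| ≤ (X ^ 2) ^ k := fun k i => by
    split_ifs with h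
    · rw [abs_pow, abs_neg, abs_of_nonneg (hlam i)]
      exact pow_le_pow_left₀ (hlam i) h k
    · rw [abs_zero]; positivity
  choose D hD using fun k => exists_diagonal e (by positivity) (hm k)
  have hU0 : ∀ i, ⟪e i, D 0 (S T x)⟫_ℝ = if lam i ≤ X ^ 2 then ⟪e i, S T x⟫_ℝ else 0 := fun i => by
    rw [hD]; split_ifs <;> simp
  have hlow := hspec (X ^ 2) (fun k => D k (S T x)) (sq_nonneg X)
    (fun k => (hop _ _).2 fun i => by
      rw [hD, hD]; split_ifs
      · ring
      · simp)
    (fun k => norm_le_of_inner_le e (by positivity) fun i => by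
      rw [hU0, hD]
      split_ifs with h
      · rw [abs_mul, abs_pow, abs_neg, abs_of_nonneg (hlam i)]
        gcongr
        exact hlam i
      · simp)
  rw [Real.sqrt_sq hX] at hlow
  set Y := S T x with hY
  have hhigh : ‖Y - D 0 Y‖ ≤ Real.exp (-X ^ 2 * T) * ‖x‖ :=
    norm_le_of_inner_le e (Real.exp_pos _).le fun i => by
      rw [inner_sub_right, hU0]
      split_ifs with h
      · rw [sub_self, abs_zero]; positivity
      · rw [sub_zero, hY, hS T hT.le, abs_mul, abs_of_pos (Real.exp_pos _)]
        gcongr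
        exact (not_le.1 h).le
  set R := restrictL2 (a := a) (b := b) hsub with hR
  have hnormR : ∀ u, ‖R u‖ ≤ ‖u‖ := fun u => by
    rw [← one_mul ‖u‖]
    exact (R.le_opNorm u).trans (mul_le_mul_of_nonneg_right
      (LinearMap.mkContinuous_norm_le _ zero_le_one _) (norm_nonneg _))
  have hsqrt : ∀ Z : State a b, √(∫ y in ω, (Z.fst y) ^ 2) = ‖R Z.fst‖ := fun Z => by
    rw [← norm_sq_restrictL2 hsub, Real.sqrt_sq (norm_nonneg _)]
  rw [hsqrt] at hlow
  have hRU : ‖R (D 0 Y).fst‖ ≤ ‖R Y.fst‖ + Real.exp (-X ^ 2 * T) * ‖x‖ := by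
    have h1 : R (D 0 Y).fst = R Y.fst - R (Y - D 0 Y).fst := by
      rw [← map_sub, WithLp.sub_fst]; simp
    rw [h1]
    refine (norm_sub_le _ _).trans ?_
    gcongr
    exact ((hnormR _).trans (norm_fst_le _)).trans hhigh
  have hE1 : 1 ≤ Real.exp (c * X) := Real.one_le_exp (by positivity)
  have hmain : ‖Y‖ ≤ C * Real.exp (c * X) * ‖R Y.fst‖ + ε / 2 * ‖x‖ := by
    have h1 : ‖Y‖ ≤ ‖D 0 Y‖ + ‖Y - D 0 Y‖ := by
      have := norm_add_le (D 0 Y) (Y - D 0 Y)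
      rwa [add_sub_cancel] at this
    have h2 : C₁ * Real.exp (c * X) * ‖R (D 0 Y).fst‖
        ≤ C₁ * Real.exp (c * X) * (‖R Y.fst‖ + Real.exp (-X ^ 2 * T) * ‖x‖) := by gcongr
    have h3 : C * Real.exp (c * X) * Real.exp (-X ^ 2 * T) * ‖x‖ ≤ ε / 2 * ‖x‖ := by gcongr
    have h4 : Real.exp (-X ^ 2 * T) * ‖x‖ ≤ Real.exp (c * X) * (Real.exp (-X ^ 2 * T) * ‖x‖) :=
      le_mul_of_one_le_left (by positivity) hE1
    have h5 : 0 ≤ Real.exp (c * X) * ‖R Y.fst‖ := by positivity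
    have h6 : C * Real.exp (c * X) * ‖R Y.fst‖ + C * Real.exp (c * X) * Real.exp (-X ^ 2 * T) * ‖x‖
        = C₁ * Real.exp (c * X) * (‖R Y.fst‖ + Real.exp (-X ^ 2 * T) * ‖x‖)
          + Real.exp (c * X) * ‖R Y.fst‖ + Real.exp (c * X) * (Real.exp (-X ^ 2 * T) * ‖x‖) := by
      rw [hC]; ring
    linarith
  rw [← norm_sq_restrictL2 hsub, ← hR]
  set κ := 2 * C * (2 * C) ^ c * Real.exp ((c ^ 2 + c) / T) / ε ^ c with hκ
  -- The halves of `κ` and `ε` leave room for squaring the sum.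
  have h7 : ‖Y‖ ≤ κ / 2 * ‖R Y.fst‖ + ε / 2 * ‖x‖ := hmain.trans (by gcongr; linarith)
  calc ‖Y‖ ^ 2 ≤ (κ / 2 * ‖R Y.fst‖ + ε / 2 * ‖x‖) ^ 2 :=
        pow_le_pow_left₀ (norm_nonneg _) h7 2
    _ ≤ κ ^ 2 * ‖R Y.fst‖ ^ 2 + ε ^ 2 * ‖x‖ ^ 2 := by
        nlinarith [sq_nonneg (κ * ‖R Y.fst‖ - ε * ‖x‖), sq_nonneg (κ * ‖R Y.fst‖),
          sq_nonneg (ε * ‖x‖)]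

/-! ### The impulsive system -/

theorem IsHeatSemigroup.final_eq {S : ℝ → State a b →L[ℝ] State a b} (hS : IsHeatSemigroup S)
    (hω : IsOpen ω) {T τ : ℝ} (hτ : 0 < τ) (hτT : τ < T) {Ψ₀ : State a b} {h : L2 ω}
    {Ψ : ℝ → State a b} (hΨ : IsImpulsiveSolution hω T τ Ψ₀ h Ψ) :
    Ψ T = S (T - τ) (S τ Ψ₀ + impulse a b hω h) := by
  -- Uniqueness is used on `[0,t]` with `t < τ`, since the curve may jump at `τ`; the left limit is
  -- then recovered by continuity of the semigroup.
  have hbefore : ∀ t ∈ Ioo 0 τ, Ψ t = S t Ψ₀ := fun t ht => by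
    have := hS.unique t ht.1 Ψ ⟨hΨ.continuousOn_before.mono (Icc_subset_Ico_right ht.2),
      fun s hs => hΨ.equation s ⟨⟨hs.1, by linarith [hs.2, ht.2]⟩, (hs.2.trans ht.2).ne⟩⟩
    rwa [hΨ.initial] at this
  obtain ⟨Ψm, hlim, hjump⟩ := hΨ.jump
  have hΨm : Ψm = S τ Ψ₀ := by
    refine tendsto_nhds_unique hlim ?_
    refine (((hS.continuous Ψ₀).tendsto τ).mono_left nhdsWithin_le_nhds).congr' ?_
    filter_upwards [Ioo_mem_nhdsLT hτ] with t ht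
    exact (hbefore t ht).symm
  have hafter := hS.unique (T - τ) (sub_pos.2 hτT) (fun t => Ψ (t + τ)) ⟨?_, fun t ht => ?_⟩
  · simp only [sub_add_cancel, zero_add] at hafter
    rw [hafter, hjump, hΨm]
  · refine hΨ.continuousOn_after.comp (Continuous.continuousOn (by fun_prop)) fun t ht => ?_
    exact ⟨by linarith [ht.1], by linarith [ht.2]⟩
  · obtain ⟨V, h1, h2⟩ := hΨ.equation (t + τ)
      ⟨⟨by linarith [ht.1], by linarith [ht.2]⟩, by
        simp only [mem_singleton_iff]; linarith [ht.1]⟩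
    exact ⟨V, h1, h2.comp_add_const t τ⟩

theorem IsHeatSemigroup.exists_impulsiveSolution {S : ℝ → State a b →L[ℝ] State a b}
    (hS : IsHeatSemigroup S) (hω : IsOpen ω) {T τ : ℝ} (hτ : 0 < τ) (Ψ₀ : State a b)
    (h : L2 ω) : ∃ Ψ, IsImpulsiveSolution hω T τ Ψ₀ h Ψ := by
  classical
  set Φ := S τ Ψ₀ + impulse a b hω h with hΦ
  have hc : Continuous fun t => S (t - τ) Φ := (hS.continuous Φ).comp (by fun_prop)
  refine ⟨fun t => if t < τ then S t Ψ₀ else S (t - τ) Φ, ?_, ?_, ?_, ?_, ?_⟩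
  · simp only [hτ, if_true]; exact hS.zero _
  · exact (hS.continuous Ψ₀).continuousOn.congr fun t ht => if_pos ht.2
  · exact hc.continuousOn.congr fun t ht => if_neg (not_lt.2 ht.1)
  · rintro t ⟨ht, htτ⟩
    rcases lt_or_gt_of_ne htτ with htτ | htτ
    · obtain ⟨V, h1, h2⟩ := hS.equation t ht.1 Ψ₀
      refine ⟨V, by rwa [if_pos htτ], h2.congr_of_eventuallyEq ?_⟩
      filter_upwards [Iio_mem_nhds htτ] with s hs
      exact if_pos hs
    · obtain ⟨V, h1, h2⟩ := hS.equation (t - τ) (sub_pos.2 htτ) Φ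
      refine ⟨V, by rwa [if_neg (not_lt.2 (le_of_lt htτ))],
        (h2.comp_sub_const t τ).congr_of_eventuallyEq ?_⟩
      filter_upwards [Ioi_mem_nhds htτ] with s hs
      exact if_neg (not_lt.2 (le_of_lt hs))
  · refine ⟨S τ Ψ₀, ?_, ?_⟩
    · refine (((hS.continuous Ψ₀).tendsto τ).mono_left nhdsWithin_le_nhds).congr' ?_
      filter_upwards [self_mem_nhdsWithin] with t ht
      exact (if_pos ht).symm
    · simp only [lt_irrefl, if_false, sub_self]
      exact hS.zero _

/-- Existence and uniqueness reduce every statement about solutions to one about an explicit vector.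
-/
theorem IsHeatSemigroup.finalState_iff {S : ℝ → State a b →L[ℝ] State a b}
    (hS : IsHeatSemigroup S) (hω : IsOpen ω) {T τ : ℝ} (hτ : 0 < τ) (hτT : τ < T) {Ψ₀ : State a b}
    {h : L2 ω} {P : State a b → Prop} :
    FinalState hω T τ Ψ₀ h P ↔ P (S (T - τ) (S τ Ψ₀ + impulse a b hω h)) := by
  constructor
  · rintro ⟨⟨Ψ, hΨ⟩, hP⟩
    rw [← hS.final_eq hω hτ hτT hΨ]
    exact hP Ψ hΨ
  · intro hP
    refine ⟨hS.exists_impulsiveSolution hω hτ Ψ₀ h, fun Ψ hΨ => ?_⟩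
    rwa [hS.final_eq hω hτ hτT hΨ]

end ImpulseHeat

end

/-! ### Observability, controllability and control cost -/

theorem mainTheorem3 (a b : ℝ) (hab : a < b) (ω : Set ℝ) (hω : IsOpen ω)
    (hne : ω.Nonempty) (hcomp : closure ω ⊆ Set.Ioo a b) :
    ∃ M₁ M₂ δ : ℝ, 0 < M₁ ∧ 0 < M₂ ∧ 0 < δ ∧
      (∀ T : ℝ, 0 < T → ∀ ϑ : ℝ → ImpulseHeat.State a b, ImpulseHeat.IsHeatSolution T ϑ →
        ∀ ε : ℝ, 0 < ε →
        ‖ϑ T‖ ^ 2 ≤ (M₁ * Real.exp (M₂ / T) / ε ^ δ) ^ 2 * (∫ x in ω, ((ϑ T).fst x) ^ 2)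
          + ε ^ 2 * ‖ϑ 0‖ ^ 2) ∧
      ∀ T τ : ℝ, 0 < τ → τ < T →
        ImpulseHeat.NullApproxControllable a b hω T τ ∧
        ImpulseHeat.ApproxControllable a b hω T τ ∧
        ∀ ε : ℝ, 0 < ε → ImpulseHeat.controlCost a b hω T τ ε ≤
          ENNReal.ofReal (M₁ * Real.exp (M₂ / (T - τ)) / ε ^ δ) := by
  have hsub : ω ⊆ Ioo a b := subset_closure.trans hcomp
  obtain ⟨ι, e, lam, hlam, hop⟩ := ImpulseHeat.exists_heat_eigenbasis hab
  obtain ⟨S, hS, hcont, hder⟩ := ImpulseHeat.exists_semigroup e hlam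
  have hsemi := ImpulseHeat.isHeatSemigroup_of_diagonal e hlam hop hS hcont hder
  obtain ⟨M₁, M₂, δ, hM₁, hM₂, hδ, hobs⟩ :=
    ImpulseHeat.exists_observability e hlam hop hS hsemi hab hω hne hsub
  obtain ⟨B, hB, hBadj⟩ := ImpulseHeat.exists_impulseCLM (a := a) (b := b) hω hsub
  refine ⟨M₁, M₂, δ, hM₁, hM₂, hδ, fun T hT ϑ hϑ ε hε => ?_, fun T τ hτ hτT => ?_⟩
  · rw [hsemi.unique T hT ϑ hϑ]
    exact hobs T hT ε hε _
  have ht : 0 < T - τ := sub_pos.2 hτT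
  have hadj : ∀ φ, (S (T - τ) ∘L B).adjoint φ = B.adjoint (S (T - τ) φ) := fun φ => by
    apply ext_inner_left ℝ
    intro u
    rw [ContinuousLinearMap.adjoint_inner_right, ContinuousLinearMap.adjoint_inner_right]
    exact hsemi.symm _ ht.le _ _
  have hobs' : ∀ ε : ℝ, 0 < ε → ∀ φ, ‖S (T - τ) φ‖ ^ 2 ≤
      (M₁ * Real.exp (M₂ / (T - τ)) / ε ^ δ) ^ 2 * ‖(S (T - τ) ∘L B).adjoint φ‖ ^ 2
        + ε ^ 2 * ‖φ‖ ^ 2 := fun ε hε φ => by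
    rw [hadj, hBadj]; exact hobs _ ht ε hε φ
  have hnull : ∀ ε : ℝ, 0 < ε → ∀ Ψ₀ : ImpulseHeat.State a b,
      ∃ h ∈ ImpulseHeat.nullControls hω T τ Ψ₀ ε,
        ‖h‖ ≤ M₁ * Real.exp (M₂ / (T - τ)) / ε ^ δ * ‖Ψ₀‖ := fun ε hε Ψ₀ => by
    -- Duality is applied to the state `S τ Ψ₀` just before the impulse. Its norm is at most `‖Ψ₀‖`,
    -- so the cost involves only the remaining time `T - τ`.
    obtain ⟨u, hu1, hu2⟩ := ImpulseHeat.exists_control_of_observability (hsemi.symm _ ht.le)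
      (S (T - τ) ∘L B) (by positivity) hε (hobs' ε hε) (S τ Ψ₀)
    have hle := hsemi.norm_le τ hτ.le Ψ₀
    have hfin : ImpulseHeat.FinalState hω T τ Ψ₀ u fun X => ‖X‖ ≤ ε * ‖Ψ₀‖ := by
      rw [hsemi.finalState_iff hω hτ hτT, ← hB, map_add]
      exact hu2.trans (by gcongr)
    exact ⟨u, hfin, hu1.trans (by gcongr)⟩
  refine ⟨fun ε hε Ψ₀ => ?_, fun Ψ₀ Ψ₁ ε hε => ?_, fun ε hε => ?_⟩
  · obtain ⟨h, hh, -⟩ := hnull ε hε Ψ₀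
    exact ⟨h, hh⟩
  -- If the observation vanishes, observability holds with no observed term for every `ε`, so `S (T
  -- - τ) φ = 0`; injectivity of the semigroup (backward uniqueness) gives `φ = 0`.
  · have hinj : ∀ φ, (S (T - τ) ∘L B).adjoint φ = 0 → φ = 0 := fun φ hφ => by
      refine hsemi.injective _ ht.le φ ?_
      have h1 : ∀ η : ℝ, 0 < η → ‖S (T - τ) φ‖ ≤ η * ‖φ‖ := fun η hη => by
        have := hobs' η hη φ
        rw [hφ, norm_zero, zero_pow two_ne_zero, mul_zero, zero_add, ← mul_pow] at this
        exact (abs_le_of_sq_le_sq' this (by positivity)).2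
      rw [← norm_le_zero_iff]
      refine le_of_forall_pos_le_add fun η hη => ?_
      refine (h1 (η / (‖φ‖ + 1)) (by positivity)).trans ?_
      rw [zero_add, div_mul_eq_mul_div, div_le_iff₀ (by positivity)]
      nlinarith [norm_nonneg φ]
    obtain ⟨u, hu⟩ := ImpulseHeat.exists_approx_preimage hinj (Ψ₁ - S (T - τ) (S τ Ψ₀)) hε
    refine ⟨u, (hsemi.finalState_iff hω hτ hτT).2 ?_⟩
    rw [← hB, map_add]
    refine le_of_eq_of_le ?_ hu
    congr 1
    rw [ContinuousLinearMap.comp_apply]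
    abel
  · refine iSup₂_le fun Ψ₀ hΨ₀ => ?_
    obtain ⟨h, hh, hle⟩ := hnull ε hε Ψ₀
    refine (iInf₂_le h hh).trans ?_
    rw [hΨ₀, mul_one] at hle
    rw [← ofReal_norm]
    exact ENNReal.ofReal_le_ofReal hle
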